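/- Let $n\ge 1$ and let $\mathbb R_n$ be the real Clifford algebra generated by $e_1,\dots,e_n$ with $e_i^2=-1$, $e_ie_j=-e_je_i$ $(i\neq j)$, with the Euclidean norm $\|\sum_A y_Ae_A\|^2=\sum_A y_A^2$. An entire left monogenic function is a $C^1$ function $f:\mathbb R^{n+1}\to\mathbb R_n$ with $\partial_{x_0}f+\sum_{i=1}^n e_i\partial_{x_i}f=0$. For $\mathbf m\in\mathbb N_0^n$ let $V_{\mathbf m}$ be the Fueter polynomial $V_{\mathbf m}(\mathbf x)=\frac{\mathbf m!}{|\mathbf m|!}\sum z_{w_1}\cdots z_{w_{|\mathbf m|}}$, $z_i=x_i-x_0e_i$, where the sum is over the distinct arrangements $(w_1,\dots,w_{|\mathbf m|})$ of the sequence in which each index $i$ occurs $m_i$ times. The Taylor series of an entire left monogenic $f$ is $f=\sum_{\mathbf m}V_{\mathbf m}a_{\mathbf m}$ with $a_{\mathbf m}=\frac1{\mathbf m!}\partial_{x_1}^{m_1}\cdots\partial_{x_n}^{m_n}f(0)$, and for $f=\sum V_{\mathbf m}a_{\mathbf m}$, $g=\sum V_{\mathbf k}b_{\mathbf k}$ the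 CK-product is $f\odot g=\sum_{\mathbf m}\sum_{\mathbf k}V_{\mathbf m+\mathbf k}\,a_{\mathbf m}b_{\mathbf k}$. Let $\rho(r)$ be a proximate order for the order $\rho>0$: $\rho(\cdot)\ge 0$ is differentiable on $[0,\infty)$, $\rho(r)\to\rho$ and $\rho'(r)\,r\ln r\to 0$ as $r\to+\infty$. For $\sigma>0$ let $A_{\rho,\sigma}$ be the space of entire left monogenic $f$ with $\|f\|_{\rho,\sigma}:=\sup_{\mathbf x\in\mathbb R^{n+1}}\|f(\mathbf x)\|\exp(-\sigma\|\mathbf x\|^{\rho(\|\mathbf x\|)})<\infty$. Then for all $\eta,\tau_1,\tau_2>0$ there is a constant $C=C(n,\eta,\tau_1,\tau_2)>0$ (depending also on the fixed function $\rho(\cdot)$) such that for every $\delta>0$, every $g_1\in A_{\rho,\tau_1}$ and every $g_2\in A_{\rho,\tau_2}$, the double series defining $g_1\odot g_2$ converges unconditionally at every point, $g_1\odot g_2\in A_{\rho,\sigma}$ with $\sigma=(1+\eta)(n+\delta+1)^\rho(\tau_1+\tau_2)$, and $$\|g_1\odot g_2\|_{\rho,\sigma}\le C(n,\eta,\tau_1,\tau_2)\,\|g_1\|_{\rho,\tau_1}\,\|g_2\|_{\rho,\tau_2}.$$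 -/

import Mathlib

/-! ## The real Clifford algebra `ℝ_n` -/

/-- The quadratic form `v ↦ -(v₁² + ⋯ + vₙ²)` on `ℝⁿ`. -/
noncomputable abbrev cliffordForm (n : ℕ) : QuadraticForm ℝ (Fin n → ℝ) :=
  QuadraticMap.weightedSumSquares ℝ (fun _ : Fin n => (-1 : ℝ))

/-- The real Clifford algebra over `n` imaginary units. -/
abbrev Cl (n : ℕ) : Type := CliffordAlgebra (cliffordForm n)

/-- The imaginary unit `e_i`. -/
noncomputable def unitE {n : ℕ} (i : Fin n) : Cl n :=
  CliffordAlgebra.ι (cliffordForm n) (Pi.single i 1)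

theorem unitE_mul_self {n : ℕ} (i : Fin n) : unitE i * unitE i = -1 := by
  unfold unitE
  rw [CliffordAlgebra.ι_sq_scalar]
  simp [Pi.single_apply]

theorem unitE_mul_add_swap {n : ℕ} {i j : Fin n} (h : i ≠ j) :
    unitE i * unitE j + unitE j * unitE i = 0 := by
  unfold unitE
  rw [CliffordAlgebra.ι_mul_ι_add_swap]
  have : QuadraticMap.polar (cliffordForm n) (Pi.single i 1) (Pi.single j 1) = 0 := by
    simp only [QuadraticMap.polar, QuadraticMap.weightedSumSquares_apply, Pi.add_apply,
      ← Finset.sum_sub_distrib]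
    refine Finset.sum_eq_zero fun k _ => ?_
    by_cases hk : k = i
    · subst hk; simp [h]
    · simp [Pi.single_apply, hk]
  rw [this, map_zero]

/-- The element `e_A = e_{i₁} ⋯ e_{i_r}`, where `A = {i₁ < ⋯ < i_r}`. -/
noncomputable def unitProd {n : ℕ} (A : Finset (Fin n)) : Cl n :=
  (A.sort.map unitE).prod

/-- The linear equivalence between the Clifford algebra and the exterior algebra. -/
noncomputable def clEquivExterior (n : ℕ) : Cl n ≃ₗ[ℝ] ExteriorAlgebra ℝ (Fin n → ℝ) :=
  letI : Invertible (2 : ℝ) := invertibleOfNonzero two_ne_zero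
  CliffordAlgebra.equivExterior (cliffordForm n)

theorem contractLeft_list_prod_eq_zero {n : ℕ} (d : Module.Dual ℝ (Fin n → ℝ))
    (l : List (Fin n)) (hd : ∀ j ∈ l, d (Pi.single j 1) = 0) :
    CliffordAlgebra.contractLeft (Q := (0 : QuadraticForm ℝ (Fin n → ℝ))) d
      ((l.map fun i => CliffordAlgebra.ι (0 : QuadraticForm ℝ (Fin n → ℝ))
        (Pi.single i 1)).prod) = 0 := by
  induction l with
  | nil => simp
  | cons a l ih =>
    rw [List.map_cons, List.prod_cons, CliffordAlgebra.contractLeft_ι_mul,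
      ih (fun j hj => hd j (List.mem_cons_of_mem _ hj)), hd a List.mem_cons_self]
    simp

theorem clEquivExterior_list_prod {n : ℕ} (l : List (Fin n)) (hl : l.Nodup) :
    clEquivExterior n ((l.map unitE).prod) =
      (l.map fun i => ExteriorAlgebra.ι ℝ (Pi.single i (1 : ℝ) : Fin n → ℝ)).prod := by
  let : Invertible (2 : ℝ) := invertibleOfNonzero two_ne_zero
  induction l with
  | nil => simp [clEquivExterior]
  | cons a l ih =>
    have hl' := List.nodup_cons.1 hl
    have ih' := ih hl'.2
    simp only [clEquivExterior, CliffordAlgebra.equivExterior,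
      CliffordAlgebra.changeFormEquiv_apply] at ih' ⊢
    rw [List.map_cons, List.prod_cons, unitE, CliffordAlgebra.changeForm_ι_mul, ih',
      List.map_cons, List.prod_cons]
    have h0 := contractLeft_list_prod_eq_zero
      (QuadraticMap.associated (R := ℝ) (-cliffordForm n) (Pi.single a 1)) l ?_
    · exact (congrArg (fun t => _ - t) h0).trans (sub_zero _)
    · intro j hj
      have hne : a ≠ j := fun h => hl'.1 (h ▸ hj)
      have hp : QuadraticMap.polar (-cliffordForm n) (Pi.single a 1) (Pi.single j 1) = 0 := by
        simp only [QuadraticMap.polar, neg_apply,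
          QuadraticMap.weightedSumSquares_apply, Pi.add_apply,
          ← Finset.sum_neg_distrib, ← Finset.sum_sub_distrib]
        refine Finset.sum_eq_zero fun k _ => ?_
        by_cases hk : k = a
        · subst hk; simp [hne]
        · simp [Pi.single_apply, hk]
      rw [QuadraticMap.associated_apply]
      rw [QuadraticMap.polar] at hp
      rw [hp, smul_zero]

theorem clEquivExterior_unitProd {n : ℕ} (A : Finset (Fin n)) :
    clEquivExterior n (unitProd A) = (Pi.basisFun ℝ (Fin n)).ExteriorAlgebra A := by
  rw [unitProd, clEquivExterior_list_prod _ (Finset.sort_nodup _ _),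
    ExteriorAlgebra.basis_apply_ofCard (Pi.basisFun ℝ (Fin n)) (rfl : A.card = A.card),
    ExteriorAlgebra.ιMulti_family, ExteriorAlgebra.ιMulti_apply,
    ← Finset.listMap_orderEmbOfFin_finRange A rfl, List.map_map, ← List.ofFn_eq_map]
  congr 2
  funext i
  simp [Set.powersetCard.ofFinEmbEquiv_symm_apply, Set.powersetCard.ofCard]

theorem linearIndependent_unitProd (n : ℕ) :
    LinearIndependent ℝ (unitProd : Finset (Fin n) → Cl n) := by
  refine LinearIndependent.of_comp (clEquivExterior n).toLinearMap ?_
  have : ((clEquivExterior n).toLinearMap ∘ (unitProd : Finset (Fin n) → Cl n)) =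
      (Pi.basisFun ℝ (Fin n)).ExteriorAlgebra := funext clEquivExterior_unitProd
  rw [this]
  exact Module.Basis.linearIndependent _

theorem span_unitProd (n : ℕ) :
    ⊤ ≤ Submodule.span ℝ (Set.range (unitProd : Finset (Fin n) → Cl n)) := by
  have hb := (Pi.basisFun ℝ (Fin n)).ExteriorAlgebra.span_eq
  have : Set.range ((Pi.basisFun ℝ (Fin n)).ExteriorAlgebra) =
      (clEquivExterior n).toLinearMap '' Set.range (unitProd : Finset (Fin n) → Cl n) := by
    rw [← Set.range_comp]
    exact congrArg Set.range (funext fun A => (clEquivExterior_unitProd A).symm)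
  rw [this, Submodule.span_image] at hb
  intro y _
  have hy : clEquivExterior n y ∈ Submodule.map (clEquivExterior n).toLinearMap
      (Submodule.span ℝ (Set.range (unitProd : Finset (Fin n) → Cl n))) := by
    rw [hb]; trivial
  obtain ⟨z, hz, hzy⟩ := hy
  exact (clEquivExterior n).injective hzy ▸ hz

/-- The basis `(e_A)_A` of the Clifford algebra. -/
noncomputable def clBasis (n : ℕ) : Module.Basis (Finset (Fin n)) ℝ (Cl n) :=
  Module.Basis.mk (linearIndependent_unitProd n) (span_unitProd n)

/-- The coordinates `(y_A)_A` of `y = ∑ y_A e_A`, as a point of a Euclidean space. -/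
noncomputable def clCoord (n : ℕ) : Cl n ≃ₗ[ℝ] EuclideanSpace ℝ (Finset (Fin n)) :=
  (clBasis n).equivFun.trans (WithLp.linearEquiv 2 ℝ (Finset (Fin n) → ℝ)).symm

/-- The Euclidean norm of the coordinates in the basis `(e_A)_A`. -/
noncomputable instance clNormedAddCommGroup (n : ℕ) : NormedAddCommGroup (Cl n) :=
  NormedAddCommGroup.induced (Cl n) (EuclideanSpace ℝ (Finset (Fin n))) (clCoord n)
    (clCoord n).injective

noncomputable instance clNormedSpace (n : ℕ) : NormedSpace ℝ (Cl n) :=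
  NormedSpace.induced ℝ (Cl n) (EuclideanSpace ℝ (Finset (Fin n))) (clCoord n)

theorem cl_norm_sq {n : ℕ} (y : Cl n) :
    ‖y‖ ^ 2 = ∑ A : Finset (Fin n), ((clBasis n).repr y A) ^ 2 := by
  have : ‖y‖ = ‖clCoord n y‖ := rfl
  rw [this, EuclideanSpace.norm_sq_eq]
  simp [clCoord]

/-! ## Monogenic functions and Fueter polynomials -/

/-- The points `(x₀, x₁, …, xₙ)` of `ℝ^{n+1}`, with the Euclidean norm. -/
abbrev Paravector (n : ℕ) : Type := EuclideanSpace ℝ (Fin (n + 1))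

/-- The partial derivative `∂_{x_j} f`. -/
noncomputable def pderiv {n : ℕ} (j : Fin (n + 1)) (f : Paravector n → Cl n) :
    Paravector n → Cl n :=
  fun x => fderiv ℝ f x (EuclideanSpace.single j 1)

/-- Entire left monogenic functions: `f` is `C¹` on `ℝ^{n+1}` and
`∂_{x₀} f + ∑ᵢ eᵢ ∂_{xᵢ} f = 0`. -/
def IsLeftMonogenic {n : ℕ} (f : Paravector n → Cl n) : Prop :=
  ContDiff ℝ 1 f ∧
    ∀ x, pderiv 0 f x + ∑ i : Fin n, unitE i * pderiv i.succ f x = 0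

/-- The iterated derivative `∂^m f = ∂_{x₁}^{m₁} ⋯ ∂_{xₙ}^{mₙ} f`. -/
noncomputable def multiDeriv {n : ℕ} (m : Fin n → ℕ) (f : Paravector n → Cl n) :
    Paravector n → Cl n :=
  (List.finRange n).foldr (fun i g => (pderiv i.succ)^[m i] g) f

/-- The hypercomplex variable `z_i = x_i - x₀ e_i`. -/
noncomputable def fueterVar {n : ℕ} (i : Fin n) (x : Paravector n) : Cl n :=
  algebraMap ℝ (Cl n) (x i.succ) - x 0 • unitE i

/-- The Fueter polynomial
`V_m(x) = (m! / |m|!) ∑ z_{w₁} ⋯ z_{w_{|m|}}`, the sum being over the `|m|! / m!` distinct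
arrangements `w` of the sequence in which each index `i` occurs `m_i` times. -/
noncomputable def fueterPoly {n : ℕ} (m : Fin n → ℕ) (x : Paravector n) : Cl n :=
  ((∏ i, ((m i).factorial : ℝ)) / ((∑ i, m i).factorial : ℝ)) •
    ∑ w : Fin (∑ i, m i) → Fin n with ∀ i, (Finset.univ.filter fun k => w k = i).card = m i,
      (List.ofFn fun k => fueterVar (w k) x).prod

/-- The coefficient `a_m = ∂^m f(0) / m!` of the Taylor series `f = ∑ V_m a_m`.
Since `V_m` restricts to `x₁^{m₁} ⋯ xₙ^{mₙ}` on `x₀ = 0`, these are the only possible coefficients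
of such a series. -/
noncomputable def taylorCoeff {n : ℕ} (f : Paravector n → Cl n) (m : Fin n → ℕ) : Cl n :=
  (∏ i, ((m i).factorial : ℝ))⁻¹ • multiDeriv m f 0

/-- The term `V_{m+k}(x) a_m b_k` of the double series defining the CK-product. -/
noncomputable def ckTerm {n : ℕ} (f g : Paravector n → Cl n) (x : Paravector n)
    (p : (Fin n → ℕ) × (Fin n → ℕ)) : Cl n :=
  fueterPoly (p.1 + p.2) x * (taylorCoeff f p.1 * taylorCoeff g p.2)

/-- The (left) Cauchy-Kowalewski product `f ⊙ g = ∑_m ∑_k V_{m+k} a_m b_k`. -/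
noncomputable def ckProduct {n : ℕ} (f g : Paravector n → Cl n) : Paravector n → Cl n :=
  fun x => ∑' p, ckTerm f g x p

/-! ## Proximate orders and the spaces `A_{ρ,σ}` -/

/-- `ρ : [0, ∞) → [0, ∞)` is a proximate order for the order `ρ₀`. -/
structure IsProximateOrder (ρ : ℝ → ℝ) (ρ₀ : ℝ) : Prop where
  order_nonneg : 0 ≤ ρ₀
  nonneg : ∀ r, 0 ≤ r → 0 ≤ ρ r
  differentiable : DifferentiableOn ℝ ρ (Set.Ici 0)
  tendsto : Filter.Tendsto ρ Filter.atTop (nhds ρ₀)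
  tendsto_deriv : Filter.Tendsto (fun r => deriv ρ r * r * Real.log r) Filter.atTop (nhds 0)

/-- The weighted values `‖f(x)‖ exp(-σ ‖x‖^{ρ(‖x‖)})`. -/
noncomputable def weighted {n : ℕ} (ρ : ℝ → ℝ) (σ : ℝ) (f : Paravector n → Cl n)
    (x : Paravector n) : ℝ :=
  ‖f x‖ * Real.exp (-σ * ‖x‖ ^ ρ ‖x‖)

/-- The space `A_{ρ,σ}` of entire left monogenic functions with finite norm. -/
def growthSpace (n : ℕ) (ρ : ℝ → ℝ) (σ : ℝ) : Set (Paravector n → Cl n) :=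
  {f | IsLeftMonogenic f ∧ BddAbove (Set.range (weighted ρ σ f))}

/-- The norm of `A_{ρ,σ}`. -/
noncomputable def growthNorm {n : ℕ} (ρ : ℝ → ℝ) (σ : ℝ) (f : Paravector n → Cl n) : ℝ :=
  ⨆ x, weighted ρ σ f x

/-! The whole estimate rests on a Cauchy inequality with geometric room to spare: if `‖f‖ ≤ M` on
the ball of radius `r`, then `‖a_m‖ ≤ C M (9/10 · (n+1)/r)^|m|` (`exists_taylorCoeff_bound`). With
`r = (n+1) max(s, 1)` this leaves `max(s, 1)^|m| ‖a_m‖` bounded by `(9/10)^|m|` times the growth of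
`f` on that ball. Since `‖V_m(x) c‖ ≤ ‖x‖^|m| ‖c‖`, choosing `s = ‖x‖` dominates the double series
by a product of two convergent geometric series. The proximate order satisfies `((n+1)s)^ρ((n+1)s) ≤
(1+η)(n+1)^ρ₀ s^ρ(s) + B` for large `s` (`exists_rpow_le`), which turns the growth of the two
factors into the required type. The room in `9/10` means that `n+1` suffices in place of `n+δ+1`, so
the constant does not depend on `δ`.

The Cauchy inequality is an energy argument. The coordinates of a monogenic function are harmonic,
and for harmonic `u` the sum `E_K` of squared derivatives of order `K` in `x₁, …, xₙ` satisfies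
`ΔE_K ≥ 2 E_{K+1}`. Iterating this in means against the weights `(1 - |y|²)₊^N` bounds `E_K(0)` by
the mean of `u²`. The derivative `∂^m u` occurs `|m|!/m!` times in `E_K`, and this multiplicity,
itself at most `n^|m|`, gives the rate.

Smoothness has to be derived from `C¹`: a weighted mean value property writes `f` as a convolution
with arbitrarily smooth kernels. Conversely, the product is monogenic because every `V_m` is and the
series may be differentiated termwise. -/

/-! ### Norm of left multiplication by units and by hypercomplex variables -/

instance clFiniteDimensional (n : ℕ) : FiniteDimensional ℝ (Cl n) :=
  Module.Finite.of_basis (clBasis n)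

theorem clBasis_apply {n : ℕ} (A : Finset (Fin n)) : clBasis n A = unitProd A := by
  simp [clBasis]

theorem unitE_mul_swap {n : ℕ} {i j : Fin n} (h : i ≠ j) :
    unitE i * unitE j = -(unitE j * unitE i) :=
  eq_neg_of_add_eq_zero_left (unitE_mul_add_swap h)

/-- Reordering distinct imaginary units changes their product by a sign. -/
theorem prod_map_unitE_perm {n : ℕ} {l l' : List (Fin n)} (h : l.Perm l') (hl : l.Nodup) :
    (l.map unitE).prod = (l'.map unitE).prod ∨ (l.map unitE).prod = -(l'.map unitE).prod := by
  induction h with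
  | nil => simp
  | cons a h ih =>
    rcases ih (List.nodup_cons.1 hl).2 with h | h <;> simp [h]
  | swap a b l =>
    right
    have hne : b ≠ a := by
      rintro rfl
      simp at hl
    simp only [List.map_cons, List.prod_cons, ← mul_assoc, unitE_mul_swap hne, neg_mul]
  | trans h₁ h₂ ih₁ ih₂ =>
    rcases ih₁ hl with h | h <;> rcases ih₂ (h₁.nodup_iff.1 hl) with h' | h' <;> simp [h, h']

/-- Toggling the membership of `i`. -/
def toggle {n : ℕ} (i : Fin n) (A : Finset (Fin n)) : Finset (Fin n) :=
  if i ∈ A then A.erase i else insert i A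

theorem toggle_toggle {n : ℕ} (i : Fin n) (A : Finset (Fin n)) : toggle i (toggle i A) = A := by
  unfold toggle
  by_cases h : i ∈ A <;> simp [h]

theorem unitE_mul_unitProd_of_notMem {n : ℕ} {i : Fin n} {A : Finset (Fin n)} (h : i ∉ A) :
    unitE i * unitProd A = unitProd (insert i A) ∨
      unitE i * unitProd A = -unitProd (insert i A) := by
  have hp : (i :: A.sort).Perm (insert i A).sort := by
    rw [List.perm_ext_iff_of_nodup]
    · intro a; simp
    · simp [h]
    · exact Finset.sort_nodup _ _
  have := prod_map_unitE_perm hp (by simp [h])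
  simpa [unitProd] using this

theorem unitE_mul_unitProd {n : ℕ} (i : Fin n) (A : Finset (Fin n)) :
    ∃ ε : ℝ, ε ^ 2 = 1 ∧ unitE i * unitProd A = ε • unitProd (toggle i A) := by
  by_cases h : i ∈ A
  · have h1 := unitE_mul_unitProd_of_notMem (Finset.notMem_erase i A)
    rw [Finset.insert_erase h] at h1
    have ht : toggle i A = A.erase i := by simp [toggle, h]
    rw [ht]
    rcases h1 with h1 | h1
    · refine ⟨-1, by norm_num, ?_⟩
      rw [← h1, ← mul_assoc, unitE_mul_self]; simp
    · refine ⟨1, by norm_num, ?_⟩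
      have : unitProd A = -(unitE i * unitProd (A.erase i)) := by rw [h1, neg_neg]
      rw [this, mul_neg, ← mul_assoc, unitE_mul_self]; simp
  · have ht : toggle i A = insert i A := by simp [toggle, h]
    rw [ht]
    rcases unitE_mul_unitProd_of_notMem h with h1 | h1
    · exact ⟨1, by norm_num, by simpa using h1⟩
    · exact ⟨-1, by norm_num, by simpa using h1⟩

/-- Left multiplication by `e_i` is a signed permutation of the orthonormal basis `(e_A)`, with
`toggle i` as the permutation. -/
theorem norm_unitE_mul {n : ℕ} (i : Fin n) (a : Cl n) : ‖unitE i * a‖ = ‖a‖ := by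
  choose ε hε hmul using unitE_mul_unitProd i
  have hrepr : ∀ B, (clBasis n).repr (unitE i * a) B =
      ε (toggle i B) * (clBasis n).repr a (toggle i B) := by
    intro B
    conv_lhs => rw [← (clBasis n).sum_repr a]
    simp only [Finset.mul_sum, mul_smul_comm, clBasis_apply, hmul, map_sum, map_smul]
    simp only [← clBasis_apply, Module.Basis.repr_self, Finsupp.coe_finsetSum, Finset.sum_apply,
      Finsupp.coe_smul, Pi.smul_apply, smul_eq_mul]
    rw [Finset.sum_eq_single (toggle i B)]
    · simp [toggle_toggle, mul_comm]
    · intro A _ hA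
      have : toggle i A ≠ B := fun h => hA (by rw [← h, toggle_toggle])
      simp [this]
    · simp
  have hsq : ‖unitE i * a‖ ^ 2 = ‖a‖ ^ 2 := by
    rw [cl_norm_sq, cl_norm_sq]
    refine Finset.sum_bijective (toggle i)
      (Function.Involutive.bijective (toggle_toggle i)) (by simp) fun B _ => ?_
    rw [hrepr, mul_pow, hε, one_mul]
  exact (pow_left_inj₀ (norm_nonneg _) (norm_nonneg _) two_ne_zero).1 hsq

theorem norm_eq_norm_clCoord {n : ℕ} (a : Cl n) : ‖a‖ = ‖clCoord n a‖ := rfl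

/-- Since `e_i (a - e_i a) = a + e_i a` and `e_i` acts isometrically, `a ± e_i a` have equal norms,
so the cross term vanishes. -/
theorem inner_clCoord_unitE_mul {n : ℕ} (i : Fin n) (a : Cl n) :
    inner ℝ (clCoord n a) (clCoord n (unitE i * a)) = 0 := by
  have key : ∀ b : Cl n, ‖b + unitE i * b‖ ^ 2 = ‖b‖ ^ 2 + 2 * inner ℝ (clCoord n b)
      (clCoord n (unitE i * b)) + ‖unitE i * b‖ ^ 2 := by
    intro b
    rw [norm_eq_norm_clCoord, norm_eq_norm_clCoord b, norm_eq_norm_clCoord (unitE i * b), map_add,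
      norm_add_sq_real]
  have h1 := key a
  have h2 : ‖a - unitE i * a‖ ^ 2 = ‖a‖ ^ 2 - 2 * inner ℝ (clCoord n a)
      (clCoord n (unitE i * a)) + ‖unitE i * a‖ ^ 2 := by
    rw [norm_eq_norm_clCoord, norm_eq_norm_clCoord a, norm_eq_norm_clCoord (unitE i * a), map_sub,
      norm_sub_sq_real]
  have h3 : unitE i * (a - unitE i * a) = a + unitE i * a := by
    rw [mul_sub, ← mul_assoc, unitE_mul_self]; simp [add_comm]
  have h4 := norm_unitE_mul i (a - unitE i * a)
  rw [h3] at h4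
  rw [h4] at h1
  linarith

theorem fueterVar_mul {n : ℕ} (i : Fin n) (x : Paravector n) (a : Cl n) :
    fueterVar i x * a = x i.succ • a - x 0 • (unitE i * a) := by
  rw [fueterVar, sub_mul, smul_mul_assoc, Algebra.smul_def (x i.succ)]

/-- Pythagoras: `a` and `e_i a` are orthogonal of equal length. The constant `1` matters, because
this is applied once per letter of a word; a larger one would be raised to the power `|m|`. -/
theorem norm_fueterVar_mul_le {n : ℕ} (i : Fin n) (x : Paravector n) (a : Cl n) :
    ‖fueterVar i x * a‖ ≤ ‖x‖ * ‖a‖ := by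
  have h1 : ‖fueterVar i x * a‖ ^ 2 = (x i.succ ^ 2 + x 0 ^ 2) * ‖a‖ ^ 2 := by
    rw [fueterVar_mul, norm_eq_norm_clCoord, map_sub, map_smul, map_smul, norm_sub_sq_real,
      norm_smul, norm_smul, inner_smul_left, inner_smul_right, inner_clCoord_unitE_mul,
      ← norm_eq_norm_clCoord, ← norm_eq_norm_clCoord, norm_unitE_mul, mul_pow, mul_pow]
    simp only [Real.norm_eq_abs, sq_abs]
    ring
  have h2 : x i.succ ^ 2 + x 0 ^ 2 ≤ ‖x‖ ^ 2 := by
    rw [EuclideanSpace.norm_sq_eq, Fin.sum_univ_succ, add_comm (x i.succ ^ 2)]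
    simp only [Real.norm_eq_abs, sq_abs]
    gcongr
    exact Finset.single_le_sum (f := fun j : Fin n => x j.succ ^ 2) (fun j _ => sq_nonneg _)
      (Finset.mem_univ i)
  refine le_of_sq_le_sq ?_ (by positivity)
  rw [h1, mul_pow]
  gcongr

/-- Left multiplication, as a continuous linear map. -/
noncomputable def mulLeftCLM {n : ℕ} (a : Cl n) : Cl n →L[ℝ] Cl n :=
  LinearMap.toContinuousLinearMap (LinearMap.mulLeft ℝ a)

/-- Right multiplication, as a continuous linear map. -/
noncomputable def mulRightCLM {n : ℕ} (a : Cl n) : Cl n →L[ℝ] Cl n :=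
  LinearMap.toContinuousLinearMap (LinearMap.mulRight ℝ a)

@[simp] theorem mulLeftCLM_apply {n : ℕ} (a b : Cl n) : mulLeftCLM a b = a * b := rfl

@[simp] theorem mulRightCLM_apply {n : ℕ} (a b : Cl n) : mulRightCLM a b = b * a := rfl

/-- The Euclidean norm need not be submultiplicative; `K` is harmless, being used only once per
term, for `a_m b_k`. -/
theorem exists_norm_mul_le (n : ℕ) : ∃ K : ℝ, 0 < K ∧ ∀ a b : Cl n, ‖a * b‖ ≤ K * ‖a‖ * ‖b‖ := by
  let T : Cl n →ₗ[ℝ] (Cl n →L[ℝ] Cl n) :=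
    (LinearMap.toContinuousLinearMap (𝕜 := ℝ) (E := Cl n) (F' := Cl n)).toLinearMap ∘ₗ
      LinearMap.mul ℝ (Cl n)
  let T' := LinearMap.toContinuousLinearMap T
  refine ⟨‖T'‖ + 1, by positivity, fun a b => ?_⟩
  calc ‖a * b‖ = ‖T' a b‖ := rfl
    _ ≤ ‖T' a‖ * ‖b‖ := (T' a).le_opNorm b
    _ ≤ ‖T'‖ * ‖a‖ * ‖b‖ := by gcongr; exact T'.le_opNorm a
    _ ≤ _ := by gcongr; linarith

/-! ### Factorization of the Laplacian -/

/-- The units `1, e_1, …, e_n`. -/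
noncomputable def paraUnit {n : ℕ} (j : Fin (n + 1)) : Cl n :=
  Fin.cons (α := fun _ => Cl n) 1 unitE j

/-- The conjugate units `1, -e_1, …, -e_n`. -/
noncomputable def paraUnitConj {n : ℕ} (j : Fin (n + 1)) : Cl n :=
  Fin.cons (α := fun _ => Cl n) 1 (fun i => -unitE i) j

theorem paraUnitConj_mul_add {n : ℕ} (j k : Fin (n + 1)) :
    paraUnitConj j * paraUnit k + paraUnitConj k * paraUnit j =
      if j = k then (2 : Cl n) else 0 := by
  refine Fin.cases ?_ (fun i => ?_) j <;> refine Fin.cases ?_ (fun l => ?_) k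
  · simp [paraUnit, paraUnitConj, one_add_one_eq_two]
  · simp [paraUnit, paraUnitConj, (Fin.succ_ne_zero l).symm]
  · simp [paraUnit, paraUnitConj]
  · by_cases h : i = l
    · subst h
      simp [paraUnit, paraUnitConj, unitE_mul_self, one_add_one_eq_two]
    · simp [paraUnit, paraUnitConj, h, unitE_mul_swap h]

/-- The Cauchy-Riemann operator factorizes the Laplacian. -/
theorem sum_paraUnitConj_mul {n : ℕ} (G : Fin (n + 1) → Fin (n + 1) → Cl n)
    (hG : ∀ j k, G j k = G k j) :
    ∑ j, paraUnitConj j * ∑ k, paraUnit k * G j k = ∑ j, G j j := by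
  -- Doubling allows the `(j, k)` and `(k, j)` terms to be paired.
  have h2 : (2 : ℝ) • ∑ j, paraUnitConj j * ∑ k, paraUnit k * G j k =
      (2 : ℝ) • ∑ j, G j j := by
    calc (2 : ℝ) • ∑ j, paraUnitConj j * ∑ k, paraUnit k * G j k
        = ∑ j, ∑ k, paraUnitConj j * (paraUnit k * G j k) +
          ∑ j, ∑ k, paraUnitConj k * (paraUnit j * G k j) := by
          rw [two_smul]
          simp only [Finset.mul_sum]
          congr 1
          exact Finset.sum_comm
      _ = ∑ j, ∑ k, (if j = k then (2 : Cl n) else 0) * G j k := by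
          simp only [← Finset.sum_add_distrib]
          refine Finset.sum_congr rfl fun j _ => Finset.sum_congr rfl fun k _ => ?_
          rw [hG k j, ← mul_assoc, ← mul_assoc, ← add_mul, paraUnitConj_mul_add]
      _ = _ := by
          simp [ite_mul, Finset.smul_sum, two_smul, two_mul]
  exact smul_right_injective _ (two_ne_zero (α := ℝ)) h2

/-! ### Words with prescribed letter counts -/

/-- The number of occurrences of the letter `i` in the word `w`. -/
def letterCount {n k : ℕ} (w : Fin k → Fin n) (i : Fin n) : ℕ :=
  (Finset.univ.filter fun j => w j = i).card

theorem letterCount_cons {n k : ℕ} (a : Fin n) (w : Fin k → Fin n) (i : Fin n) :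
    letterCount (Fin.cons a w : Fin (k + 1) → Fin n) i =
      letterCount w i + (Pi.single a 1 : Fin n → ℕ) i := by
  simp only [letterCount, Finset.card_filter, Fin.sum_univ_succ, Fin.cons_zero, Fin.cons_succ,
    Pi.single_apply, eq_comm (a := i)]
  rw [add_comm]

theorem sum_letterCount {n k : ℕ} (w : Fin k → Fin n) : ∑ i, letterCount w i = k := by
  simp only [letterCount]
  rw [← Finset.card_eq_sum_card_fiberwise (f := w) (t := Finset.univ) (by simp)]
  simp

theorem letterCount_eq_count {n k : ℕ} (w : Fin k → Fin n) (i : Fin n) :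
    letterCount w i = (List.ofFn w).count i := by
  induction k with
  | zero => simp [letterCount]
  | succ k ih =>
    rw [List.ofFn_succ, List.count_cons, ← Fin.cons_self_tail w, letterCount_cons, ih]
    simp [Pi.single_apply, eq_comm (a := i)]

/-- The sum of the products `z_{w₁} ⋯ z_{w_k}` over the words `w` of length `k` in which each
letter `i` occurs `m i` times. The multi-index is allowed to have negative entries, in which case
the sum is empty. -/
noncomputable def wordSum {n : ℕ} {A : Type*} [Ring A] (z : Fin n → A) (k : ℕ) (m : Fin n → ℤ) :
    A :=
  ∑ w : Fin k → Fin n with (fun i => (letterCount w i : ℤ)) = m, (List.ofFn fun j => z (w j)).prod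

section wordSum

variable {n : ℕ} {A : Type*} [Ring A] (z : Fin n → A)

theorem wordSum_zero (m : Fin n → ℤ) : wordSum z 0 m = if m = 0 then 1 else 0 := by
  simp only [wordSum, Finset.sum_filter, Finset.univ_unique, Finset.sum_singleton, List.ofFn_zero,
    List.prod_nil]
  congr 1
  simp [letterCount, funext_iff, eq_comm (a := (0 : ℤ))]

theorem wordSum_succ (k : ℕ) (m : Fin n → ℤ) :
    wordSum z (k + 1) m = ∑ i, z i * wordSum z k (m - Pi.single i 1) := by
  simp only [wordSum, Finset.sum_filter, Finset.mul_sum]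
  rw [← (Fin.consEquiv fun _ : Fin (k + 1) => Fin n).sum_comp, Fintype.sum_prod_type]
  refine Finset.sum_congr rfl fun a _ => Finset.sum_congr rfl fun w _ => ?_
  have : ((fun i => (letterCount (Fin.cons a w : Fin (k + 1) → Fin n) i : ℤ)) = m) ↔
      (fun i => (letterCount w i : ℤ)) = m - Pi.single a 1 := by
    rw [eq_sub_iff_add_eq]
    have : (fun i => (letterCount (Fin.cons a w : Fin (k + 1) → Fin n) i : ℤ)) =
        (fun i => (letterCount w i : ℤ)) + Pi.single a 1 := by
      funext i
      rw [letterCount_cons]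
      simp [Pi.single_apply]
    rw [this]
  simp only [Fin.consEquiv, Equiv.coe_fn_mk, this, List.ofFn_succ, Fin.cons_zero, Fin.cons_succ,
    List.prod_cons, mul_ite, mul_zero]

theorem wordSum_eq_zero_of_neg (k : ℕ) (m : Fin n → ℤ) {i : Fin n} (h : m i < 0) :
    wordSum z k m = 0 := by
  refine Finset.sum_eq_zero fun w hw => ?_
  have : (letterCount w i : ℤ) = m i := congrFun (Finset.mem_filter.1 hw).2 i
  omega

end wordSum

/-- The number of words with `m i` letters `i`. -/
noncomputable def wordCard {n : ℕ} (m : Fin n → ℕ) : ℕ :=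
  (Finset.univ.filter fun w : Fin (∑ i, m i) → Fin n => ∀ i, letterCount w i = m i).card

/-- The multinomial count, by removing the first letter: words starting with `i` contribute `m_i
k!`, and these add up to `(k+1) k!`. -/
theorem prod_factorial_mul_wordSum_one {n : ℕ} (k : ℕ) (m : Fin n → ℤ) (hm : ∀ i, 0 ≤ m i)
    (hk : ∑ i, m i = k) :
    (∏ i, ((m i).toNat.factorial : ℝ)) * wordSum (fun _ => (1 : ℝ)) k m = k.factorial := by
  induction k generalizing m with
  | zero =>
    have : m = 0 := by
      funext i
      exact (Finset.sum_eq_zero_iff_of_nonneg fun i _ => hm i).1 (by simpa using hk) i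
        (Finset.mem_univ i)
    simp [wordSum_zero, this]
  | succ k ih =>
    rw [wordSum_succ, Finset.mul_sum]
    have : ∀ i, (∏ j, ((m j).toNat.factorial : ℝ)) *
        (1 * wordSum (fun _ => (1 : ℝ)) k (m - Pi.single i 1)) = m i * k.factorial := by
      intro i
      rcases (hm i).eq_or_lt with h0 | h0
      · rw [wordSum_eq_zero_of_neg _ _ _ (i := i) (by simp [← h0]), ← h0]; simp
      · rw [← ih (m - Pi.single i 1)]
        · rw [one_mul, ← mul_assoc]
          congr 1
          rw [← Finset.mul_prod_erase _ _ (Finset.mem_univ i),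
            ← Finset.mul_prod_erase _ _ (Finset.mem_univ i), ← mul_assoc]
          congr 1
          · obtain ⟨a, ha⟩ : ∃ a : ℕ, m i = a + 1 := ⟨(m i - 1).toNat, by omega⟩
            have h1 : (m i).toNat = a + 1 := by omega
            have h2 : ((m - Pi.single i 1 : Fin n → ℤ) i).toNat = a := by simp [ha]
            rw [h1, h2, ha, Nat.factorial_succ]
            push_cast
            rfl
          · refine Finset.prod_congr rfl fun j hj => ?_
            simp [Finset.ne_of_mem_erase hj]
        · intro j
          by_cases hj : j = i
          · subst hj; simp; omega
          · simp [hj, hm j]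
        · simp only [Pi.sub_apply, Finset.sum_sub_distrib, hk]
          simp
    simp only [this]
    rw [← Finset.sum_mul, Nat.factorial_succ]
    have : ∑ i, (m i : ℝ) = k + 1 := by exact_mod_cast hk
    rw [this]; push_cast; ring

theorem wordSum_natCast_eq {n : ℕ} {A : Type*} [Ring A] (z : Fin n → A) (m : Fin n → ℕ) (k : ℕ) :
    wordSum z k (fun i => (m i : ℤ)) =
      ∑ w : Fin k → Fin n with ∀ i, letterCount w i = m i,
        (List.ofFn fun j => z (w j)).prod := by
  simp only [wordSum, funext_iff, Nat.cast_inj]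

theorem wordSum_one_eq_wordCard {n : ℕ} (m : Fin n → ℕ) :
    wordSum (fun _ => (1 : ℝ)) (∑ i, m i) (fun i => (m i : ℤ)) = wordCard m := by
  rw [wordSum_natCast_eq]
  simp [wordCard, List.ofFn_const]

theorem prod_factorial_mul_wordCard {n : ℕ} (m : Fin n → ℕ) :
    (∏ i, ((m i).factorial : ℝ)) * wordCard m = (∑ i, m i).factorial := by
  have := prod_factorial_mul_wordSum_one (∑ i, m i) (fun i => (m i : ℤ)) (by simp) (by simp)
  rw [wordSum_one_eq_wordCard] at this
  simpa using this

theorem wordCard_le {n : ℕ} (m : Fin n → ℕ) : wordCard m ≤ n ^ (∑ i, m i) := by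
  refine (Finset.card_filter_le _ _).trans ?_
  simp

/-! ### Fueter polynomials -/

theorem fueterPoly_eq_wordSum {n : ℕ} (m : Fin n → ℕ) (x : Paravector n) :
    fueterPoly m x = ((∏ i, ((m i).factorial : ℝ)) / ((∑ i, m i).factorial : ℝ)) •
      wordSum (fun i => fueterVar i x) (∑ i, m i) (fun i => (m i : ℤ)) := by
  rw [wordSum_natCast_eq]
  rfl

theorem norm_list_prod_fueterVar_mul_le {n : ℕ} (x : Paravector n) (l : List (Fin n)) (c : Cl n) :
    ‖(l.map fun i => fueterVar i x).prod * c‖ ≤ ‖x‖ ^ l.length * ‖c‖ := by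
  induction l with
  | nil => simp
  | cons a l ih =>
    rw [List.map_cons, List.prod_cons, mul_assoc, List.length_cons, pow_succ', mul_assoc]
    exact (norm_fueterVar_mul_le _ _ _).trans (by gcongr)

theorem norm_wordSum_fueterVar_mul_le {n : ℕ} (x : Paravector n) (k : ℕ) (m : Fin n → ℤ)
    (c : Cl n) :
    ‖wordSum (fun i => fueterVar i x) k m * c‖ ≤
      wordSum (fun _ => (1 : ℝ)) k m * (‖x‖ ^ k * ‖c‖) := by
  rw [wordSum, wordSum, Finset.sum_mul, Finset.sum_mul]
  refine (norm_sum_le _ _).trans (Finset.sum_le_sum fun w _ => ?_)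
  have := norm_list_prod_fueterVar_mul_le x (List.ofFn w) c
  rw [List.map_ofFn, List.length_ofFn] at this
  simpa [List.ofFn_const, Function.comp_def] using this

theorem norm_fueterPoly_mul_le {n : ℕ} (m : Fin n → ℕ) (x : Paravector n) (c : Cl n) :
    ‖fueterPoly m x * c‖ ≤ ‖x‖ ^ (∑ i, m i) * ‖c‖ := by
  rw [fueterPoly_eq_wordSum, smul_mul_assoc, norm_smul, Real.norm_of_nonneg (by positivity)]
  have h := norm_wordSum_fueterVar_mul_le x (∑ i, m i) (fun i => (m i : ℤ)) c
  rw [wordSum_one_eq_wordCard] at h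
  calc _ ≤ (∏ i, ((m i).factorial : ℝ)) / ((∑ i, m i).factorial : ℝ) *
        (wordCard m * (‖x‖ ^ (∑ i, m i) * ‖c‖)) := by gcongr
    _ = _ := by
      rw [← mul_assoc, div_mul_eq_mul_div, prod_factorial_mul_wordCard, div_self (by positivity),
        one_mul]

/-! ### Differentiation and monogenicity of Fueter polynomials -/

/-- `fueterVar i`, as a continuous linear map. -/
noncomputable def fueterVarCLM {n : ℕ} (i : Fin n) : Paravector n →L[ℝ] Cl n :=
  (EuclideanSpace.proj i.succ).smulRight (1 : Cl n) -
    (EuclideanSpace.proj 0).smulRight (unitE i)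

theorem fueterVarCLM_apply {n : ℕ} (i : Fin n) (x : Paravector n) :
    fueterVarCLM i x = fueterVar i x := by
  simp [fueterVarCLM, fueterVar, Algebra.algebraMap_eq_smul_one]

/-- The exchange relation behind the symmetry of Fueter polynomials. -/
theorem fueterVar_mul_exchange {n : ℕ} (i j : Fin n) (x h : Paravector n) :
    fueterVar i x * fueterVar j h + fueterVar j x * fueterVar i h =
      fueterVar j h * fueterVar i x + fueterVar i h * fueterVar j x := by
  simp only [fueterVar, Algebra.algebraMap_eq_smul_one, sub_mul, mul_sub, smul_mul_assoc,
    mul_smul_comm, one_mul, mul_one, smul_sub, smul_smul]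
  module

/-- The derivative of `wordSum` as a function of `x`. -/
noncomputable def wordSumDeriv {n : ℕ} (k : ℕ) (m : Fin n → ℤ) (x : Paravector n) :
    Paravector n →L[ℝ] Cl n :=
  (k : ℝ) • ∑ i, (mulRightCLM (wordSum (fun i => fueterVar i x) (k - 1) (m - Pi.single i 1))).comp
    (fueterVarCLM i)

theorem wordSumDeriv_apply {n : ℕ} (k : ℕ) (m : Fin n → ℤ) (x h : Paravector n) :
    wordSumDeriv k m x h = (k : ℝ) • ∑ i, fueterVar i h *
      wordSum (fun i => fueterVar i x) (k - 1) (m - Pi.single i 1) := by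
  simp [wordSumDeriv, fueterVarCLM_apply]

/-- The variables do not commute, but the word sums are symmetric in the two removed letters, so
only the symmetrized product in `i, j` matters. -/
theorem sum_fueterVar_mul_exchange {n : ℕ} (k : ℕ) (m : Fin n → ℤ) (x h : Paravector n) :
    ∑ i, fueterVar i x * ∑ j, fueterVar j h *
      wordSum (fun i => fueterVar i x) k (m - Pi.single i 1 - Pi.single j 1) =
    ∑ j, fueterVar j h * ∑ i, fueterVar i x *
      wordSum (fun i => fueterVar i x) k (m - Pi.single j 1 - Pi.single i 1) := by
  set S := wordSum (fun i => fueterVar i x) k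
  have hS : ∀ i j : Fin n, S (m - Pi.single i 1 - Pi.single j 1) =
      S (m - Pi.single j 1 - Pi.single i 1) := fun i j => by rw [sub_right_comm]
  apply smul_right_injective _ (two_ne_zero (α := ℝ))
  simp only [two_smul, Finset.mul_sum]
  conv_lhs => arg 2; rw [Finset.sum_comm]
  conv_rhs => arg 2; rw [Finset.sum_comm]
  simp only [← Finset.sum_add_distrib]
  refine Finset.sum_congr rfl fun i _ => Finset.sum_congr rfl fun j _ => ?_
  rw [hS j i, ← mul_assoc, ← mul_assoc, ← mul_assoc, ← mul_assoc, ← add_mul, ← add_mul,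
    fueterVar_mul_exchange, add_comm]

/-- After summation over all words, every position of the differentiated letter contributes the same
as the leftmost one, hence the factor `k`. In the inductive step the exchange identity moves `h`
past the first letter. -/
theorem hasFDerivAt_wordSum {n : ℕ} (k : ℕ) (m : Fin n → ℤ) (x : Paravector n) :
    HasFDerivAt (fun x => wordSum (fun i => fueterVar i x) k m) (wordSumDeriv k m x) x := by
  induction k generalizing m with
  | zero =>
    simp only [wordSum_zero]
    have : wordSumDeriv 0 m x = 0 := by simp [wordSumDeriv]
    rw [this]
    exact hasFDerivAt_const _ _
  | succ k ih =>
    obtain ⟨B, hB⟩ : ∃ B : Cl n →L[ℝ] Cl n →L[ℝ] Cl n, ∀ a b, B a b = a * b :=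
      ⟨LinearMap.toContinuousLinearMap
        ((LinearMap.toContinuousLinearMap (𝕜 := ℝ) (E := Cl n) (F' := Cl n)).toLinearMap ∘ₗ
          LinearMap.mul ℝ (Cl n)), fun a b => rfl⟩
    have hterm : ∀ i : Fin n, HasFDerivAt
        (fun x => fueterVar i x * wordSum (fun i => fueterVar i x) k (m - Pi.single i 1))
        ((mulRightCLM (wordSum (fun i => fueterVar i x) k (m - Pi.single i 1))).comp
          (fueterVarCLM i) + (mulLeftCLM (fueterVar i x)).comp
            (wordSumDeriv k (m - Pi.single i 1) x)) x := by
      intro i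
      have h1 := B.hasFDerivAt_of_bilinear (fueterVarCLM i).hasFDerivAt (ih (m - Pi.single i 1))
      simp only [hB, fueterVarCLM_apply] at h1
      refine h1.congr_fderiv ?_
      ext h
      simp [hB, add_comm, fueterVarCLM_apply]
    have hsum := HasFDerivAt.fun_sum fun i (_ : i ∈ Finset.univ) => hterm i
    simp only [← wordSum_succ] at hsum
    refine hsum.congr_fderiv ?_
    ext h : 1
    simp only [sum_apply, add_apply, ContinuousLinearMap.comp_apply,
      mulRightCLM_apply, mulLeftCLM_apply, fueterVarCLM_apply, wordSumDeriv_apply,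
      Finset.sum_add_distrib, mul_smul_comm]
    rw [← Finset.smul_sum, sum_fueterVar_mul_exchange, add_tsub_cancel_right]
    -- The truncated `k - 1` in `wordSumDeriv` is wrong only at `k = 0`, where the factor `k` kills
    -- the term.
    rcases k with _ | k
    · simp
    · simp only [Nat.add_sub_cancel, ← wordSum_succ]
      push_cast
      module

/-- The derivative of the Fueter polynomial `V_m`. -/
noncomputable def fueterPolyDeriv {n : ℕ} (m : Fin n → ℕ) (x : Paravector n) :
    Paravector n →L[ℝ] Cl n :=
  ((∏ i, ((m i).factorial : ℝ)) / ((∑ i, m i).factorial : ℝ)) •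
    wordSumDeriv (∑ i, m i) (fun i => (m i : ℤ)) x

theorem hasFDerivAt_fueterPoly {n : ℕ} (m : Fin n → ℕ) (x : Paravector n) :
    HasFDerivAt (fueterPoly m) (fueterPolyDeriv m x) x := by
  have : fueterPoly m = fun x => ((∏ i, ((m i).factorial : ℝ)) / ((∑ i, m i).factorial : ℝ)) •
      wordSum (fun i => fueterVar i x) (∑ i, m i) (fun i => (m i : ℤ)) :=
    funext (fueterPoly_eq_wordSum m)
  rw [this]
  exact (hasFDerivAt_wordSum (∑ i, m i) (fun i => (m i : ℤ)) x).const_smul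
    ((∏ i, ((m i).factorial : ℝ)) / ((∑ i, m i).factorial : ℝ))

theorem continuous_wordSumDeriv {n : ℕ} (k : ℕ) (m : Fin n → ℤ) :
    Continuous (wordSumDeriv k m : Paravector n → Paravector n →L[ℝ] Cl n) := by
  have hc : ∀ j (m : Fin n → ℤ), Continuous fun x : Paravector n =>
      wordSum (fun i => fueterVar i x) j m := fun j m =>
    continuous_iff_continuousAt.2 fun x => (hasFDerivAt_wordSum j m x).continuousAt
  have hR : Continuous (mulRightCLM : Cl n → Cl n →L[ℝ] Cl n) :=
    (LinearMap.toContinuousLinearMap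
      ((LinearMap.toContinuousLinearMap (𝕜 := ℝ) (E := Cl n) (F' := Cl n)).toLinearMap ∘ₗ
        (LinearMap.mul ℝ (Cl n)).flip)).continuous
  have hsum : Continuous fun x : Paravector n => ∑ i,
      (mulRightCLM (wordSum (fun i => fueterVar i x) (k - 1) (m - Pi.single i 1))).comp
        (fueterVarCLM i) :=
    continuous_finsetSum _ fun i _ => (hR.comp (hc _ _)).clm_comp continuous_const
  exact hsum.const_smul (k : ℝ)

theorem continuous_fueterPolyDeriv {n : ℕ} (m : Fin n → ℕ) :
    Continuous (fueterPolyDeriv m : Paravector n → Paravector n →L[ℝ] Cl n) :=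
  (continuous_wordSumDeriv (∑ i, m i) (fun i => (m i : ℤ))).const_smul
    ((∏ i, ((m i).factorial : ℝ)) / ((∑ i, m i).factorial : ℝ))

theorem norm_fueterPolyDeriv_apply_mul_le {n : ℕ} (m : Fin n → ℕ) (x h : Paravector n) (c : Cl n) :
    ‖fueterPolyDeriv m x h * c‖ ≤
      (∑ i, m i : ℕ) * ‖x‖ ^ ((∑ i, m i) - 1) * ‖h‖ * ‖c‖ := by
  set k := ∑ i, m i with hk
  rw [fueterPolyDeriv, smul_apply, wordSumDeriv_apply, smul_mul_assoc,
    smul_mul_assoc, norm_smul, norm_smul, Real.norm_of_nonneg (by positivity),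
    Real.norm_of_nonneg (by positivity), Finset.sum_mul, ← hk]
  rcases Nat.eq_zero_or_pos k with h0 | h0
  · simp [h0]
  have h1 : ‖∑ i, fueterVar i h * wordSum (fun i => fueterVar i x) (k - 1)
      ((fun i => (m i : ℤ)) - Pi.single i 1) * c‖ ≤
      wordCard m * (‖h‖ * (‖x‖ ^ (k - 1) * ‖c‖)) := by
    rw [← wordSum_one_eq_wordCard, ← hk]
    obtain ⟨j, hj⟩ : ∃ j, k = j + 1 := ⟨k - 1, by omega⟩
    rw [hj, wordSum_succ, Finset.sum_mul, Nat.add_sub_cancel]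
    refine (norm_sum_le _ _).trans (Finset.sum_le_sum fun i _ => ?_)
    rw [mul_assoc, one_mul]
    refine (norm_fueterVar_mul_le _ _ _).trans ?_
    refine (mul_le_mul_of_nonneg_left (norm_wordSum_fueterVar_mul_le _ _ _ _)
      (norm_nonneg h)).trans_eq ?_
    ring
  calc _ ≤ (∏ i, ((m i).factorial : ℝ)) / (k.factorial : ℝ) *
        (k * (wordCard m * (‖h‖ * (‖x‖ ^ (k - 1) * ‖c‖)))) := by gcongr
    _ = ((∏ i, ((m i).factorial : ℝ)) * wordCard m) / (k.factorial : ℝ) *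
        (k * ‖x‖ ^ (k - 1) * ‖h‖ * ‖c‖) := by ring
    _ = _ := by
      rw [prod_factorial_mul_wordCard, ← hk, div_self (by positivity), one_mul]

theorem fueterVar_single_zero {n : ℕ} (i : Fin n) :
    fueterVar i (EuclideanSpace.single 0 1) = -unitE i := by
  simp [fueterVar]

theorem fueterVar_single_succ {n : ℕ} (i j : Fin n) :
    fueterVar i (EuclideanSpace.single j.succ 1) = if i = j then 1 else 0 := by
  by_cases h : i = j <;> simp [fueterVar, h]

/-- Because the increment stands leftmost in the derivative, the direction `x₀` gives `-∑ e_i S_i`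
and the direction `x_i` gives `S_i`, with the same `S_i`. -/
theorem fueterPolyDeriv_cauchyRiemann {n : ℕ} (m : Fin n → ℕ) (x : Paravector n) :
    fueterPolyDeriv m x (EuclideanSpace.single 0 1) +
      ∑ i : Fin n, unitE i * fueterPolyDeriv m x (EuclideanSpace.single i.succ 1) = 0 := by
  simp only [fueterPolyDeriv, smul_apply, wordSumDeriv_apply,
    fueterVar_single_zero, fueterVar_single_succ, ite_mul, one_mul, zero_mul, Finset.sum_ite_eq',
    Finset.mem_univ, if_true, mul_smul_comm, ← Finset.smul_sum, ← smul_add, neg_mul,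
    Finset.sum_neg_distrib, neg_add_cancel, smul_zero]

open MeasureTheory Filter Topology

open scoped ContDiff

/-! ### Radial weights of finite smoothness -/

section Weights

variable {d : ℕ}

theorem hasDerivAt_max_zero_pow (N : ℕ) (s : ℝ) :
    HasDerivAt (fun s : ℝ => (max 0 s) ^ (N + 2)) ((N + 2 : ℝ) * (max 0 s) ^ (N + 1)) s := by
  have hne : ∀ s : ℝ, s ≠ 0 →
      HasDerivAt (fun s : ℝ => (max 0 s) ^ (N + 2)) ((N + 2 : ℝ) * (max 0 s) ^ (N + 1)) s := by
    intro s hs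
    rcases lt_or_gt_of_ne hs with h | h
    · rw [max_eq_left h.le, zero_pow (by omega), mul_zero]
      refine (hasDerivAt_const s (0 : ℝ)).congr_of_eventuallyEq ?_
      filter_upwards [gt_mem_nhds h] with r hr
      rw [max_eq_left hr.le, zero_pow (by omega)]
    · rw [max_eq_right h.le]
      have h1 := hasDerivAt_pow (N + 2) s
      push_cast at h1
      refine h1.congr_of_eventuallyEq ?_
      filter_upwards [lt_mem_nhds h] with r hr
      rw [max_eq_right hr.le]
  by_cases hs : s = 0
  · subst hs
    exact hasDerivAt_of_hasDerivAt_of_ne (fun y hy => hne y hy) (by fun_prop) (by fun_prop)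
  · exact hne s hs

theorem contDiff_max_zero_pow (N : ℕ) : ContDiff ℝ N (fun s : ℝ => (max 0 s) ^ (N + 1)) := by
  induction N with
  | zero => exact contDiff_zero.2 (by fun_prop)
  | succ N ih =>
    push_cast
    rw [contDiff_succ_iff_deriv]
    refine ⟨fun s => (hasDerivAt_max_zero_pow N s).differentiableAt, by simp, ?_⟩
    have : deriv (fun s : ℝ => (max 0 s) ^ (N + 1 + 1)) =
        fun s => (N + 2 : ℝ) * (max 0 s) ^ (N + 1) :=
      funext fun s => (hasDerivAt_max_zero_pow N s).deriv
    rw [this]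
    exact contDiff_const.mul ih

/-- The radial weight `(1 - |y|²)₊ ^ N`. -/
noncomputable def radialWeight (N : ℕ) (y : EuclideanSpace ℝ (Fin d)) : ℝ :=
  (max 0 (1 - ‖y‖ ^ 2)) ^ N

theorem contDiff_radialWeight (N : ℕ) :
    ContDiff ℝ N (radialWeight (N + 1) : EuclideanSpace ℝ (Fin d) → ℝ) :=
  (contDiff_max_zero_pow N).comp (contDiff_const.sub (contDiff_norm_sq ℝ))

theorem continuous_radialWeight (N : ℕ) :
    Continuous (radialWeight N : EuclideanSpace ℝ (Fin d) → ℝ) := by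
  unfold radialWeight
  fun_prop

theorem radialWeight_nonneg (N : ℕ) (y : EuclideanSpace ℝ (Fin d)) : 0 ≤ radialWeight N y := by
  unfold radialWeight
  positivity

theorem radialWeight_neg (N : ℕ) (y : EuclideanSpace ℝ (Fin d)) :
    radialWeight N (-y) = radialWeight N y := by
  simp [radialWeight]

theorem radialWeight_eq_zero (N : ℕ) {y : EuclideanSpace ℝ (Fin d)} (hy : 1 < ‖y‖) :
    radialWeight (N + 1) y = 0 := by
  rw [radialWeight, max_eq_left (by nlinarith), zero_pow (by omega)]

theorem hasCompactSupport_radialWeight (N : ℕ) :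
    HasCompactSupport (radialWeight (N + 1) : EuclideanSpace ℝ (Fin d) → ℝ) :=
  HasCompactSupport.intro (isCompact_closedBall 0 1) fun y hy =>
    radialWeight_eq_zero N (by simpa using hy)

/-- The partial derivative in the direction `j`. -/
noncomputable def partialD {F : Type*} [NormedAddCommGroup F] [NormedSpace ℝ F] (j : Fin d)
    (f : EuclideanSpace ℝ (Fin d) → F) : EuclideanSpace ℝ (Fin d) → F :=
  fun x => fderiv ℝ f x (EuclideanSpace.single j 1)

theorem partialD_radialWeight (N : ℕ) (j : Fin d) (y : EuclideanSpace ℝ (Fin d)) :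
    partialD j (radialWeight (N + 2)) y = -(2 * (N + 2 : ℝ)) * (radialWeight (N + 1) y * y j) := by
  have h1 : HasFDerivAt (fun y : EuclideanSpace ℝ (Fin d) => 1 - ‖y‖ ^ 2)
      (-((2 : ℕ) • innerSL ℝ y)) y := (hasStrictFDerivAt_norm_sq y).hasFDerivAt.const_sub 1
  have h2 := (hasDerivAt_max_zero_pow N (1 - ‖y‖ ^ 2)).comp_hasFDerivAt y h1
  have h3 : HasFDerivAt (radialWeight (N + 2)) _ y := h2
  rw [partialD, h3.fderiv]
  simp [radialWeight, EuclideanSpace.inner_single_right]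
  ring

/-- The total mass of the radial weight. -/
noncomputable def radialMass (d N : ℕ) : ℝ :=
  ∫ y : EuclideanSpace ℝ (Fin d), radialWeight N y

theorem integrable_radialWeight (N : ℕ) :
    Integrable (radialWeight (N + 1) : EuclideanSpace ℝ (Fin d) → ℝ) :=
  (continuous_radialWeight _).integrable_of_hasCompactSupport (hasCompactSupport_radialWeight N)

/-- On the ball of radius `1/2` the base of the weight is at least `3/4`. This crude rate enters the
Cauchy estimate. -/
theorem exists_le_radialMass (d : ℕ) :
    ∃ c : ℝ, 0 < c ∧ ∀ N : ℕ, c * (3 / 4 : ℝ) ^ (N + 1) ≤ radialMass d (N + 1) := by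
  refine ⟨volume.real (Metric.closedBall (0 : EuclideanSpace ℝ (Fin d)) (1 / 2)), ?_, fun N => ?_⟩
  · exact ENNReal.toReal_pos (Metric.measure_closedBall_pos _ _ (by norm_num)).ne'
      (isCompact_closedBall _ _).measure_lt_top.ne
  · calc _ = ∫ y in Metric.closedBall (0 : EuclideanSpace ℝ (Fin d)) (1 / 2),
          (3 / 4 : ℝ) ^ (N + 1) := by rw [setIntegral_const, smul_eq_mul]
      _ ≤ ∫ y in Metric.closedBall (0 : EuclideanSpace ℝ (Fin d)) (1 / 2),
          radialWeight (N + 1) y := by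
        refine setIntegral_mono_on (integrableOn_const (isCompact_closedBall _ _).measure_lt_top.ne)
          (integrable_radialWeight N).integrableOn measurableSet_closedBall fun y hy => ?_
        rw [mem_closedBall_zero_iff] at hy
        refine pow_le_pow_left₀ (by norm_num) (le_max_of_le_right ?_) _
        nlinarith [norm_nonneg y]
      _ ≤ _ := setIntegral_le_integral (integrable_radialWeight N)
        (Eventually.of_forall fun y => radialWeight_nonneg _ y)

theorem radialMass_pos (d N : ℕ) : 0 < radialMass d (N + 1) := by
  obtain ⟨c, hc, h⟩ := exists_le_radialMass d
  exact (by positivity : 0 < c * (3 / 4 : ℝ) ^ (N + 1)).trans_le (h N)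

end Weights

/-! ### Partial derivatives and dilated weighted means -/

section Calculus

variable {d : ℕ} {F : Type*} [NormedAddCommGroup F] [NormedSpace ℝ F]

theorem contDiff_partialD {k l : WithTop ℕ∞} {f : EuclideanSpace ℝ (Fin d) → F}
    (hf : ContDiff ℝ k f) (hl : l + 1 ≤ k) (j : Fin d) : ContDiff ℝ l (partialD j f) :=
  (hf.fderiv_right hl).clm_apply contDiff_const

theorem partialD_comm {f : EuclideanSpace ℝ (Fin d) → F} (hf : ContDiff ℝ 2 f) (i j : Fin d) :
    partialD i (partialD j f) = partialD j (partialD i f) := by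
  funext x
  have hd : DifferentiableAt ℝ (fderiv ℝ f) x :=
    ((hf.fderiv_right (m := 1) (by norm_num)).differentiable (by norm_num)).differentiableAt
  have h : ∀ v w : EuclideanSpace ℝ (Fin d),
      fderiv ℝ (fun x => fderiv ℝ f x v) x w = fderiv ℝ (fderiv ℝ f) x w v := by
    intro v w
    rw [fderiv_clm_apply hd (by fun_prop)]
    simp
  refine (h _ _).trans (Eq.trans ?_ (h _ _).symm)
  exact (hf.contDiffAt.isSymmSndFDerivAt (by simp)) _ _

theorem partialD_comp_smul {f : EuclideanSpace ℝ (Fin d) → F} (hf : ContDiff ℝ 1 f) (j : Fin d)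
    (t : ℝ) (y : EuclideanSpace ℝ (Fin d)) :
    partialD j (fun y => f (t • y)) y = t • partialD j f (t • y) := by
  simp only [partialD]
  have h1 := ((hf.differentiable one_ne_zero) (t • y)).hasFDerivAt.comp y
    ((hasFDerivAt_id (𝕜 := ℝ) y).const_smul t)
  have h2 : HasFDerivAt (fun y => f (t • y)) _ y := h1
  rw [h2.fderiv]
  simp

theorem partialD_clm_comp {G : Type*} [NormedAddCommGroup G] [NormedSpace ℝ G] (L : F →L[ℝ] G)
    {f : EuclideanSpace ℝ (Fin d) → F} (hf : ContDiff ℝ 1 f) (j : Fin d) :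
    partialD j (fun x => L (f x)) = fun x => L (partialD j f x) := by
  funext x
  have h2 : HasFDerivAt (fun y => L (f y)) _ x :=
    L.hasFDerivAt.comp x ((hf.differentiable one_ne_zero) x).hasFDerivAt
  simp [partialD, h2.fderiv]

theorem fderiv_apply_eq_sum_partialD (f : EuclideanSpace ℝ (Fin d) → F)
    (x y : EuclideanSpace ℝ (Fin d)) : fderiv ℝ f x y = ∑ j, y j • partialD j f x := by
  conv_lhs => rw [← (EuclideanSpace.basisFun (Fin d) ℝ).sum_repr y]
  simp [partialD]

theorem integrable_smul_of_hasCompactSupport {W : EuclideanSpace ℝ (Fin d) → ℝ}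
    {G : EuclideanSpace ℝ (Fin d) → F} (hW : Continuous W) (hWc : HasCompactSupport W)
    (hG : Continuous G) : Integrable (fun y => W y • G y) :=
  (hW.smul hG).integrable_of_hasCompactSupport hWc.smul_right

theorem hasCompactSupport_partialD {W : EuclideanSpace ℝ (Fin d) → F}
    (hWc : HasCompactSupport W) (j : Fin d) : HasCompactSupport (partialD j W) :=
  hWc.fderiv_apply (𝕜 := ℝ) _

theorem integral_smul_partialD {W : EuclideanSpace ℝ (Fin d) → ℝ}
    {G : EuclideanSpace ℝ (Fin d) → F} (hW : ContDiff ℝ 1 W) (hWc : HasCompactSupport W)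
    (hG : ContDiff ℝ 1 G) (j : Fin d) :
    ∫ y, W y • partialD j G y = -∫ y, partialD j W y • G y := by
  have hWp := (contDiff_partialD (l := 0) hW (by simp) j).continuous
  have hGp := (contDiff_partialD (l := 0) hG (by simp) j).continuous
  exact integral_smul_fderiv_eq_neg_fderiv_smul_of_integrable
    (integrable_smul_of_hasCompactSupport hWp (hasCompactSupport_partialD hWc j) hG.continuous)
    (integrable_smul_of_hasCompactSupport hW.continuous hWc hGp)
    (integrable_smul_of_hasCompactSupport hW.continuous hWc hG.continuous)
    (fun x _ => hW.differentiable one_ne_zero x) (fun x _ => hG.differentiable one_ne_zero x)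

theorem hasDerivAt_integral_radialWeight_smul {g : EuclideanSpace ℝ (Fin d) → F}
    (hg : ContDiff ℝ 1 g) (N : ℕ) (t₀ : ℝ) :
    HasDerivAt (fun t : ℝ => ∫ y, radialWeight (N + 1) y • g (t • y))
      (∫ y, radialWeight (N + 1) y • fderiv ℝ g (t₀ • y) y) t₀ := by
  have hg' : Continuous (fderiv ℝ g) := hg.continuous_fderiv one_ne_zero
  have hw := continuous_radialWeight (d := d) (N + 1)
  have hgc := hg.continuous
  obtain ⟨B, hB⟩ := (isCompact_closedBall (0 : EuclideanSpace ℝ (Fin d))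
    (|t₀| + 1)).exists_bound_of_continuousOn hg'.continuousOn
  refine (hasDerivAt_integral_of_dominated_loc_of_deriv_le
    (F := fun t y => radialWeight (N + 1) y • g (t • y))
    (F' := fun t y => radialWeight (N + 1) y • fderiv ℝ g (t • y) y)
    (bound := fun y => radialWeight (N + 1) y * B) (Metric.ball_mem_nhds t₀ one_pos)
    (Eventually.of_forall fun t => (by fun_prop : Continuous _).aestronglyMeasurable) ?_
    (by fun_prop : Continuous _).aestronglyMeasurable ?_ ?_ ?_).2
  · exact integrable_smul_of_hasCompactSupport hw (hasCompactSupport_radialWeight N) (by fun_prop)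
  · refine Eventually.of_forall fun y t ht => ?_
    rw [norm_smul, Real.norm_of_nonneg (radialWeight_nonneg _ _)]
    rcases le_or_gt ‖y‖ 1 with hy | hy
    · refine mul_le_mul_of_nonneg_left ?_ (radialWeight_nonneg _ _)
      have ht' : |t| ≤ |t₀| + 1 := by
        rw [Metric.mem_ball, Real.dist_eq] at ht
        have := abs_sub_abs_le_abs_sub t t₀
        linarith
      have h1 : ‖fderiv ℝ g (t • y)‖ ≤ B := by
        refine hB _ ?_
        rw [mem_closedBall_zero_iff, norm_smul, Real.norm_eq_abs]
        nlinarith [norm_nonneg y, abs_nonneg t, abs_nonneg t₀]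
      calc _ ≤ ‖fderiv ℝ g (t • y)‖ * ‖y‖ := ContinuousLinearMap.le_opNorm _ _
        _ ≤ B * 1 := by
          have : 0 ≤ B := (norm_nonneg _).trans h1
          gcongr
        _ = B := mul_one B
    · rw [radialWeight_eq_zero N hy]; simp
  · exact (integrable_radialWeight N).mul_const B
  · refine Eventually.of_forall fun y t _ => ?_
    have h1 : HasDerivAt (fun t : ℝ => t • y) y t := by
      simpa using (hasDerivAt_id t).smul_const y
    have h2 := ((hg.differentiable one_ne_zero) (t • y)).hasFDerivAt.comp_hasDerivAt t h1
    exact h2.const_smul _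

/-- The factor `y_j` times the weight is a multiple of `∂_j` of the next weight. No integration by
parts is made yet, so `C¹` is enough. -/
theorem integral_radialWeight_smul_fderiv {g : EuclideanSpace ℝ (Fin d) → F}
    (hg : ContDiff ℝ 1 g) (N : ℕ) (t : ℝ) :
    ∫ y, radialWeight (N + 1) y • fderiv ℝ g (t • y) y =
      (-(2 * (N + 2 : ℝ))⁻¹) •
        ∑ j, ∫ y, partialD j (radialWeight (N + 2)) y • partialD j g (t • y) := by
  have hgp := fun j => (contDiff_partialD (l := 0) hg (by simp) j).continuous
  have hw := continuous_radialWeight (d := d) (N + 1)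
  rw [← integral_finsetSum, ← integral_smul]
  · congr 1
    funext y
    rw [fderiv_apply_eq_sum_partialD, Finset.smul_sum, Finset.smul_sum]
    refine Finset.sum_congr rfl fun j _ => ?_
    rw [partialD_radialWeight, smul_smul, smul_smul]
    congr 1
    field_simp
  · intro j _
    simp only [partialD_radialWeight]
    have h1 : Integrable fun y : EuclideanSpace ℝ (Fin d) =>
        radialWeight (N + 1) y • ((-(2 * (N + 2 : ℝ)) * y j) • partialD j g (t • y)) := by
      refine integrable_smul_of_hasCompactSupport hw (hasCompactSupport_radialWeight N) ?_
      have := hgp j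
      fun_prop
    refine h1.congr (Eventually.of_forall fun y => ?_)
    simp only [smul_smul]
    congr 1
    ring

/-- The Laplacian. -/
noncomputable def laplace (f : EuclideanSpace ℝ (Fin d) → F) (x : EuclideanSpace ℝ (Fin d)) : F :=
  ∑ j, partialD j (partialD j f) x

/-- One integration by parts in the previous formula. The weight exponent rises by one as the
Laplacian appears, which makes the formula iterable. -/
theorem hasDerivAt_integral_radialWeight_smul_laplace {g : EuclideanSpace ℝ (Fin d) → F}
    (hg : ContDiff ℝ 2 g) (N : ℕ) (t : ℝ) :
    HasDerivAt (fun t : ℝ => ∫ y, radialWeight (N + 1) y • g (t • y))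
      ((t / (2 * (N + 2 : ℝ))) • ∫ y, radialWeight (N + 2) y • laplace g (t • y)) t := by
  have hg1 : ContDiff ℝ 1 g := hg.of_le (by norm_num)
  refine (hasDerivAt_integral_radialWeight_smul hg1 N t).congr_deriv ?_
  rw [integral_radialWeight_smul_fderiv hg1]
  have hp : ∀ j, ContDiff ℝ 1 (partialD j g) := fun j => contDiff_partialD hg (by norm_num) j
  have hpp := fun j => (contDiff_partialD (l := 0) (hp j) (by simp) j).continuous
  have hW : ContDiff ℝ 1 (radialWeight (N + 2) : EuclideanSpace ℝ (Fin d) → ℝ) :=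
    (contDiff_radialWeight (N + 1)).of_le (by exact_mod_cast Nat.le_add_left 1 N)
  have hterm : ∀ j, ∫ y, partialD j (radialWeight (N + 2)) y • partialD j g (t • y) =
      -(t • ∫ y, radialWeight (N + 2) y • partialD j (partialD j g) (t • y)) := by
    intro j
    rw [← neg_eq_iff_eq_neg,
      ← integral_smul_partialD (G := fun y => partialD j g (t • y)) hW
        (hasCompactSupport_radialWeight (N + 1)) ((hp j).comp (contDiff_id.const_smul t)) j,
      ← integral_smul]
    congr 1
    funext y
    rw [partialD_comp_smul (hp j), smul_comm]
  simp only [hterm, laplace, Finset.smul_sum]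
  rw [integral_finsetSum]
  · simp only [Finset.smul_sum]
    refine Finset.sum_congr rfl fun j _ => ?_
    rw [smul_neg, neg_smul, neg_neg, smul_smul]
    congr 1
    field_simp
  · intro j _
    exact integrable_smul_of_hasCompactSupport hW.continuous
      (hasCompactSupport_radialWeight (N + 1)) ((hpp j).comp (by fun_prop))

end Calculus

/-! ### Mean value property, smoothness and harmonicity of monogenic functions -/

section Regularity

variable {n : ℕ}

theorem sum_paraUnit_mul_partialD {f : Paravector n → Cl n} (hf : IsLeftMonogenic f)
    (x : Paravector n) : ∑ k, paraUnit k * partialD k f x = 0 := by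
  rw [Fin.sum_univ_succ]
  simp only [paraUnit, Fin.cons_zero, one_mul, Fin.cons_succ]
  exact hf.2 x

theorem IsLeftMonogenic.comp_add_left {f : Paravector n → Cl n} (hf : IsLeftMonogenic f)
    (a : Paravector n) : IsLeftMonogenic fun x => f (a + x) := by
  refine ⟨hf.1.comp (contDiff_const.add contDiff_id), fun x => ?_⟩
  have : ∀ j, pderiv j (fun x => f (a + x)) x = pderiv j f (a + x) := fun j => by
    simp only [pderiv, fderiv_comp_add_left]
  simp only [this, hf.2]

/-- Integration by parts puts both derivatives on `W`, where they commute; `G` is only `C¹`. -/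
theorem integral_partialD_smul_swap {d : ℕ} {F : Type*} [NormedAddCommGroup F] [NormedSpace ℝ F]
    {W : EuclideanSpace ℝ (Fin d) → ℝ} (hW : ContDiff ℝ 2 W)
    (hWc : HasCompactSupport W) {G : EuclideanSpace ℝ (Fin d) → F} (hG : ContDiff ℝ 1 G)
    (j k : Fin d) :
    ∫ y, partialD j W y • partialD k G y = ∫ y, partialD k W y • partialD j G y := by
  have hWp : ∀ j, ContDiff ℝ 1 (partialD j W) := fun j => contDiff_partialD hW (by norm_num) j
  rw [integral_smul_partialD (hWp j) (hasCompactSupport_partialD hWc j) hG,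
    integral_smul_partialD (hWp k) (hasCompactSupport_partialD hWc k) hG, partialD_comm hW]

theorem integral_partialD_smul_partialD_comp_smul_swap {d : ℕ} {F : Type*} [NormedAddCommGroup F]
    [NormedSpace ℝ F] {W : EuclideanSpace ℝ (Fin d) → ℝ} (hW : ContDiff ℝ 2 W)
    (hWc : HasCompactSupport W) {G : EuclideanSpace ℝ (Fin d) → F} (hG : ContDiff ℝ 1 G)
    (t : ℝ) (j k : Fin d) :
    ∫ y, partialD j W y • partialD k G (t • y) = ∫ y, partialD k W y • partialD j G (t • y) := by
  -- At `t = 0` the dilation cannot be undone; there both sides vanish because `∂_j W` has integral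
  -- zero.
  by_cases ht : t = 0
  · subst ht
    have h0 : ∀ (j : Fin d) (c : F), ∫ y, partialD j W y • c = 0 := by
      intro j c
      have := integral_smul_partialD (G := fun _ => c) (hW.of_le (by norm_num)) hWc contDiff_const j
      rw [← neg_eq_iff_eq_neg] at this
      rw [← this]
      simp [partialD]
    simp only [zero_smul, h0]
  · have h := integral_partialD_smul_swap hW hWc (hG.comp (contDiff_id.const_smul t)) j k
    have hc : ∀ (j : Fin d) (y : EuclideanSpace ℝ (Fin d)),
        partialD j (G ∘ fun x => t • id x) y = t • partialD j G (t • y) :=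
      fun j y => partialD_comp_smul hG j t y
    simp only [hc, smul_comm _ t, integral_smul] at h
    exact smul_right_injective _ ht h

/-- The `t`-derivative is a multiple of the trace of the matrix `∫ ∂_j W ∂_k f(ty)`. That matrix is
symmetric, and the Cauchy-Riemann equation annihilates each row contracted with the units, so the
factorization of the Laplacian makes the trace vanish without second derivatives of `f`. -/
theorem integral_radialWeight_smul_comp_smul {f : Paravector n → Cl n} (hf : IsLeftMonogenic f)
    (N : ℕ) (t : ℝ) :
    ∫ y, radialWeight (N + 2) y • f (t • y) = radialMass (n + 1) (N + 2) • f 0 := by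
  have hder : ∀ t : ℝ,
      HasDerivAt (fun t : ℝ => ∫ y, radialWeight (N + 2) y • f (t • y)) 0 t := by
    intro t
    refine (hasDerivAt_integral_radialWeight_smul hf.1 (N + 1) t).congr_deriv ?_
    rw [integral_radialWeight_smul_fderiv hf.1]
    have hW : ContDiff ℝ 2 (radialWeight (N + 3) : Paravector n → ℝ) :=
      (contDiff_radialWeight (N + 2)).of_le (by exact_mod_cast Nat.le_add_left 2 N)
    have hWc : HasCompactSupport (radialWeight (N + 3) : Paravector n → ℝ) :=
      hasCompactSupport_radialWeight (N + 2)
    have hfp := fun k => (contDiff_partialD (l := 0) hf.1 (by simp) k).continuous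
    have hWp := fun k => (contDiff_partialD (l := 0) hW (by norm_num) k).continuous
    have hint : ∀ j k : Fin (n + 1), Integrable fun y : Paravector n =>
        partialD j (radialWeight (N + 3)) y • partialD k f (t • y) := fun j k =>
      integrable_smul_of_hasCompactSupport (hWp j) (hasCompactSupport_partialD hWc j)
        ((hfp k).comp (by fun_prop))
    have hsum : ∀ j, ∑ k, paraUnit k *
        ∫ y, partialD j (radialWeight (N + 3)) y • partialD k f (t • y) = 0 := by
      intro j
      have : ∀ k, paraUnit k * ∫ y, partialD j (radialWeight (N + 3)) y • partialD k f (t • y) =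
          ∫ y, partialD j (radialWeight (N + 3)) y • (paraUnit k * partialD k f (t • y)) := by
        intro k
        rw [← mulLeftCLM_apply, ← ContinuousLinearMap.integral_comp_comm _ (hint j k)]
        simp
      simp only [this]
      rw [← integral_finsetSum]
      · simp only [← Finset.smul_sum, sum_paraUnit_mul_partialD hf, smul_zero, integral_zero]
      · intro k _
        exact integrable_smul_of_hasCompactSupport (hWp j) (hasCompactSupport_partialD hWc j)
          ((mulLeftCLM (paraUnit k)).continuous.comp ((hfp k).comp (by fun_prop)))
    have key := sum_paraUnitConj_mul
      (fun j k => ∫ y, partialD j (radialWeight (N + 3)) y • partialD k f (t • y))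
      (fun j k => integral_partialD_smul_partialD_comp_smul_swap hW hWc hf.1 t j k)
    simp only [hsum, mul_zero, Finset.sum_const_zero] at key
    rw [← key, smul_zero]
  have hconst := is_const_of_deriv_eq_zero (fun t => (hder t).differentiableAt)
    (fun t => (hder t).deriv) t 0
  rw [hconst]
  simp only [zero_smul]
  rw [integral_smul_const]
  rfl

/-- Left monogenic functions have the mean value property. -/
theorem IsLeftMonogenic.integral_radialWeight_smul_add {f : Paravector n → Cl n}
    (hf : IsLeftMonogenic f) (N : ℕ) (x : Paravector n) :
    ∫ y, radialWeight (N + 2) y • f (x + y) = radialMass (n + 1) (N + 2) • f x := by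
  have := integral_radialWeight_smul_comp_smul (hf.comp_add_left x) N 1
  simpa using this

/-- By the mean value property `f` is a multiple of its own convolution with a compactly supported
`C^N` weight, for every `N`. -/
theorem IsLeftMonogenic.contDiff {f : Paravector n → Cl n} (hf : IsLeftMonogenic f) :
    ContDiff ℝ ∞ f := by
  rw [contDiff_infty]
  intro N
  have hconv : (f : Paravector n → Cl n) = fun x => (radialMass (n + 1) (N + 2))⁻¹ •
      (MeasureTheory.convolution f (radialWeight (N + 2))
        (ContinuousLinearMap.lsmul ℝ ℝ : ℝ →L[ℝ] Cl n →L[ℝ] Cl n).flip volume) x := by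
    funext x
    rw [eq_inv_smul_iff₀ (radialMass_pos (n + 1) (N + 1)).ne',
      ← hf.integral_radialWeight_smul_add, convolution_def,
      ← integral_add_left_eq_self (fun y => ((ContinuousLinearMap.lsmul ℝ ℝ :
        ℝ →L[ℝ] Cl n →L[ℝ] Cl n).flip (f y)) (radialWeight (N + 2) (x - y))) x]
    congr 1
    funext y
    simp [radialWeight_neg]
  rw [hconv]
  refine ContDiff.const_smul _ ?_
  exact HasCompactSupport.contDiff_convolution_right _ (hasCompactSupport_radialWeight (N + 1))
    hf.1.continuous.locallyIntegrable
    ((contDiff_radialWeight (N + 1)).of_le (by exact_mod_cast Nat.le_succ N))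

theorem IsLeftMonogenic.laplace_eq_zero {f : Paravector n → Cl n} (hf : IsLeftMonogenic f)
    (x : Paravector n) : laplace f x = 0 := by
  have h2 : ContDiff ℝ 2 f := contDiff_infty.1 hf.contDiff 2
  have hp : ∀ j, ContDiff ℝ 1 (partialD j f) := fun j => contDiff_partialD h2 (by norm_num) j
  rw [laplace, ← sum_paraUnitConj_mul (fun j k => partialD j (partialD k f) x)
    (fun j k => by rw [partialD_comm h2])]
  refine Finset.sum_eq_zero fun j _ => ?_
  have h0 : partialD j (fun x => ∑ k, paraUnit k * partialD k f x) x =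
      ∑ k, paraUnit k * partialD j (partialD k f) x := by
    have h1 : ∀ k, HasFDerivAt (fun x => paraUnit k * partialD k f x)
        ((mulLeftCLM (paraUnit k)).comp (fderiv ℝ (partialD k f) x)) x := fun k =>
      (mulLeftCLM (paraUnit k)).hasFDerivAt.comp x
        ((hp k).differentiable one_ne_zero x).hasFDerivAt
    have h2 := HasFDerivAt.fun_sum fun k (_ : k ∈ Finset.univ) => h1 k
    rw [partialD, h2.fderiv]
    simp [partialD]
  rw [← h0]
  simp only [sum_paraUnit_mul_partialD hf]
  simp [partialD]

end Regularity

/-! ### Iterated derivatives along words -/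

section WordDeriv

variable {n : ℕ} {F : Type*} [NormedAddCommGroup F] [NormedSpace ℝ F]

/-- The iterated partial derivative along a word in `x₁, …, xₙ`. -/
noncomputable def wordDeriv (l : List (Fin n)) (f : Paravector n → F) : Paravector n → F :=
  l.foldr (fun i g => partialD i.succ g) f

theorem contDiff_partialD_infty {d : ℕ} {f : EuclideanSpace ℝ (Fin d) → F} (hf : ContDiff ℝ ∞ f)
    (j : Fin d) : ContDiff ℝ ∞ (partialD j f) :=
  contDiff_partialD hf (by simp) j

theorem contDiff_wordDeriv {f : Paravector n → F} (hf : ContDiff ℝ ∞ f) (l : List (Fin n)) :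
    ContDiff ℝ ∞ (wordDeriv l f) := by
  induction l with
  | nil => exact hf
  | cons a l ih => exact contDiff_partialD_infty ih _

theorem wordDeriv_perm {f : Paravector n → F} (hf : ContDiff ℝ ∞ f) {l l' : List (Fin n)}
    (h : l.Perm l') : wordDeriv l f = wordDeriv l' f := by
  induction h with
  | nil => rfl
  | cons a h ih => exact congrArg (partialD a.succ) ih
  | swap a b l => exact partialD_comm (contDiff_infty.1 (contDiff_wordDeriv hf l) 2) _ _
  | trans h₁ h₂ ih₁ ih₂ => exact ih₁.trans ih₂

theorem wordDeriv_clm_comp {G : Type*} [NormedAddCommGroup G] [NormedSpace ℝ G] (L : F →L[ℝ] G)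
    {f : Paravector n → F} (hf : ContDiff ℝ ∞ f) (l : List (Fin n)) :
    wordDeriv l (fun x => L (f x)) = fun x => L (wordDeriv l f x) := by
  induction l with
  | nil => rfl
  | cons a l ih =>
    change partialD a.succ (wordDeriv l fun x => L (f x)) = _
    rw [ih, partialD_clm_comp L (contDiff_infty.1 (contDiff_wordDeriv hf l) 1)]
    rfl

/-- The nondecreasing word in which each letter `i` occurs `m i` times. -/
def sortedWord (m : Fin n → ℕ) : List (Fin n) :=
  (List.finRange n).flatMap fun i => List.replicate (m i) i

theorem wordDeriv_replicate (f : Paravector n → F) (i : Fin n) (k : ℕ) :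
    wordDeriv (List.replicate k i) f = (partialD i.succ)^[k] f := by
  induction k with
  | zero => rfl
  | succ k ih =>
    rw [Function.iterate_succ_apply', ← ih]
    rfl

theorem multiDeriv_eq_wordDeriv (m : Fin n → ℕ) (f : Paravector n → Cl n) :
    multiDeriv m f = wordDeriv (sortedWord m) f := by
  unfold multiDeriv sortedWord
  induction List.finRange n with
  | nil => rfl
  | cons a l ih =>
    rw [List.foldr_cons, List.flatMap_cons, ih]
    have : wordDeriv (List.replicate (m a) a ++ l.flatMap fun i => List.replicate (m i) i) f =
        wordDeriv (List.replicate (m a) a)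
          (wordDeriv (l.flatMap fun i => List.replicate (m i) i) f) := by
      simp [wordDeriv]
    rw [this, wordDeriv_replicate]
    rfl

theorem count_sortedWord (m : Fin n → ℕ) (i : Fin n) : (sortedWord m).count i = m i := by
  simp only [sortedWord, List.count_flatMap, Function.comp_def, List.count_replicate]
  rw [← List.ofFn_eq_map, List.sum_ofFn]
  simp

theorem perm_sortedWord {k : ℕ} {w : Fin k → Fin n} {m : Fin n → ℕ}
    (h : ∀ i, letterCount w i = m i) : (List.ofFn w).Perm (sortedWord m) := by
  rw [List.perm_iff_count]
  intro i
  rw [count_sortedWord, ← letterCount_eq_count, h]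

end WordDeriv

/-! ### Energy of harmonic functions and the Pizzetti-type bound -/

section Energy

variable {n : ℕ}

theorem laplace_partialD {d : ℕ} {u : EuclideanSpace ℝ (Fin d) → ℝ} (hu : ContDiff ℝ ∞ u)
    (h0 : ∀ x, laplace u x = 0) (j : Fin d) (x : EuclideanSpace ℝ (Fin d)) :
    laplace (partialD j u) x = 0 := by
  have h1 : ∀ i, partialD i (partialD i (partialD j u)) = partialD j (partialD i (partialD i u)) :=
    fun i => by
      rw [partialD_comm (contDiff_infty.1 hu 2) i j,
        partialD_comm (contDiff_infty.1 (contDiff_partialD_infty hu i) 2) i j]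
  have h2 : partialD j (laplace u) x = ∑ i, partialD j (partialD i (partialD i u)) x := by
    have := HasFDerivAt.fun_sum fun i (_ : i ∈ Finset.univ) =>
      ((contDiff_infty.1 (contDiff_partialD_infty (contDiff_partialD_infty hu i) i) 1).differentiable
        one_ne_zero x).hasFDerivAt
    have h3 : HasFDerivAt (laplace u) _ x := this
    rw [partialD, h3.fderiv]
    simp [partialD]
  simp only [laplace, h1]
  rw [← h2, funext h0]
  simp [partialD]

theorem laplace_wordDeriv {u : Paravector n → ℝ} (hu : ContDiff ℝ ∞ u)
    (h0 : ∀ x, laplace u x = 0) (l : List (Fin n)) (x : Paravector n) :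
    laplace (wordDeriv l u) x = 0 := by
  induction l generalizing x with
  | nil => exact h0 x
  | cons a l ih => exact laplace_partialD (contDiff_wordDeriv hu l) ih _ x

theorem laplace_sq {d : ℕ} {v : EuclideanSpace ℝ (Fin d) → ℝ} (hv : ContDiff ℝ 2 v)
    (x : EuclideanSpace ℝ (Fin d)) :
    laplace (fun x => v x ^ 2) x = 2 * ∑ j, partialD j v x ^ 2 + 2 * v x * laplace v x := by
  have h1 : ∀ j, partialD j (fun x => v x ^ 2) = fun x => 2 * (v x * partialD j v x) := by
    intro j
    funext y
    have := ((hv.differentiable (by norm_num)) y).hasFDerivAt.pow 2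
    rw [partialD, this.fderiv]
    simp [partialD]
    ring
  have h2 : ∀ j, partialD j (fun x => 2 * (v x * partialD j v x)) x =
      2 * (partialD j v x ^ 2 + v x * partialD j (partialD j v) x) := by
    intro j
    have := ((((hv.differentiable (by norm_num)) x).hasFDerivAt.mul
      ((contDiff_partialD (l := 1) hv (by norm_num) j).differentiable
        one_ne_zero x).hasFDerivAt).const_mul 2)
    have h3 : HasFDerivAt (fun x => 2 * (v x * partialD j v x)) _ x := this
    rw [partialD, h3.fderiv]
    simp [partialD]
    ring
  simp only [laplace, h1, h2, Finset.mul_sum, ← Finset.sum_add_distrib]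
  exact Finset.sum_congr rfl fun j _ => by ring

theorem laplace_sum {d : ℕ} {ι : Type*} {s : Finset ι} {v : ι → EuclideanSpace ℝ (Fin d) → ℝ}
    (hv : ∀ i, ContDiff ℝ 2 (v i)) (x : EuclideanSpace ℝ (Fin d)) :
    laplace (fun x => ∑ i ∈ s, v i x) x = ∑ i ∈ s, laplace (v i) x := by
  have h1 : ∀ (v : ι → EuclideanSpace ℝ (Fin d) → ℝ) (_ : ∀ i, ContDiff ℝ 1 (v i)) (j : Fin d),
      partialD j (fun x => ∑ i ∈ s, v i x) = fun x => ∑ i ∈ s, partialD j (v i) x := by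
    intro v hv j
    funext y
    have := HasFDerivAt.fun_sum fun i (_ : i ∈ s) =>
      ((hv i).differentiable one_ne_zero y).hasFDerivAt
    rw [partialD, this.fderiv]
    simp [partialD]
  simp only [laplace]
  rw [Finset.sum_comm]
  refine Finset.sum_congr rfl fun j _ => ?_
  rw [h1 v (fun i => (hv i).of_le (by norm_num)),
    h1 _ (fun i => contDiff_partialD (hv i) (by norm_num) j)]

/-- The sum of the squares of the partial derivatives of order `K` in `x₁, …, xₙ`. -/
noncomputable def gradEnergy (u : Paravector n → ℝ) (K : ℕ) (x : Paravector n) : ℝ :=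
  ∑ w : Fin K → Fin n, wordDeriv (List.ofFn w) u x ^ 2

theorem contDiff_gradEnergy {u : Paravector n → ℝ} (hu : ContDiff ℝ ∞ u) (K : ℕ) :
    ContDiff ℝ ∞ (gradEnergy u K) :=
  ContDiff.sum fun _ _ => (contDiff_wordDeriv hu _).pow 2

theorem gradEnergy_nonneg (u : Paravector n → ℝ) (K : ℕ) (x : Paravector n) :
    0 ≤ gradEnergy u K x :=
  Finset.sum_nonneg fun _ _ => sq_nonneg _

/-- For harmonic `v`, `Δ(v²) = 2|∇v|²`. The inequality comes from dropping the `x₀`-derivatives. -/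
theorem two_mul_gradEnergy_succ_le {u : Paravector n → ℝ} (hu : ContDiff ℝ ∞ u)
    (h0 : ∀ x, laplace u x = 0) (K : ℕ) (x : Paravector n) :
    2 * gradEnergy u (K + 1) x ≤ laplace (gradEnergy u K) x := by
  have hc := fun w : Fin K → Fin n => contDiff_infty.1 (contDiff_wordDeriv hu (List.ofFn w)) 2
  have h1 : laplace (gradEnergy u K) x =
      ∑ w : Fin K → Fin n, 2 * ∑ j, partialD j (wordDeriv (List.ofFn w) u) x ^ 2 := by
    refine (laplace_sum (fun w => (hc w).pow 2) x).trans (Finset.sum_congr rfl fun w _ => ?_)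
    rw [laplace_sq (hc w), laplace_wordDeriv hu h0, mul_zero, add_zero]
  have h2 : gradEnergy u (K + 1) x =
      ∑ w : Fin K → Fin n, ∑ i : Fin n, partialD i.succ (wordDeriv (List.ofFn w) u) x ^ 2 := by
    rw [gradEnergy, ← (Fin.consEquiv fun _ : Fin (K + 1) => Fin n).sum_comp,
      Fintype.sum_prod_type, Finset.sum_comm]
    simp [Fin.consEquiv, List.ofFn_succ, wordDeriv]
  rw [h1, h2, Finset.mul_sum]
  refine Finset.sum_le_sum fun w _ => ?_
  rw [Fin.sum_univ_succ]
  have := sq_nonneg (partialD 0 (wordDeriv (List.ofFn w) u) x)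
  linarith

/-- Derivatives commute, so each arrangement of `m` contributes the same square to the energy. -/
theorem wordCard_mul_sq_le_gradEnergy {u : Paravector n → ℝ} (hu : ContDiff ℝ ∞ u)
    (m : Fin n → ℕ) (x : Paravector n) :
    wordCard m * wordDeriv (sortedWord m) u x ^ 2 ≤ gradEnergy u (∑ i, m i) x := by
  rw [wordCard, gradEnergy, ← nsmul_eq_mul, ← Finset.sum_const]
  refine (Finset.sum_congr rfl fun w hw => ?_).trans_le
    (Finset.sum_le_sum_of_subset_of_nonneg (Finset.filter_subset _ _) fun _ _ _ => sq_nonneg _)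
  rw [wordDeriv_perm hu (perm_sortedWord (Finset.mem_filter.1 hw).2)]

/-- A lower bound of Pizzetti type for the weighted means of a sequence of functions each of which
dominates the Laplacian of the previous one. -/
theorem le_integral_radialWeight_of_two_mul_le_laplace {d : ℕ}
    {E : ℕ → EuclideanSpace ℝ (Fin d) → ℝ} (hE : ∀ k, ContDiff ℝ 2 (E k))
    (hpos : ∀ k x, 0 ≤ E k x) (hlap : ∀ k x, 2 * E (k + 1) x ≤ laplace (E k) x)
    (j k N : ℕ) {t : ℝ} (ht : 0 ≤ t) :
    E (k + j) 0 * radialMass d (N + 1 + j) * t ^ (2 * j) * (N + 1).factorial ≤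
      2 ^ j * j.factorial * (N + 1 + j).factorial *
        ∫ y, radialWeight (N + 1) y * E k (t • y) := by
  induction j generalizing k N t with
  | zero =>
    set A : ℝ → ℝ := fun t => ∫ y, radialWeight (N + 1) y * E k (t • y)
    have hA : ∀ t, HasDerivAt A _ t := fun t =>
      hasDerivAt_integral_radialWeight_smul_laplace (hE k) N t
    have hmono : MonotoneOn A (Set.Ici 0) := by
      refine monotoneOn_of_deriv_nonneg (convex_Ici 0)
        (fun t _ => (hA t).continuousAt.continuousWithinAt)
        (fun t _ => (hA t).differentiableAt.differentiableWithinAt) fun t ht => ?_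
      rw [interior_Ici, Set.mem_Ioi] at ht
      rw [(hA t).deriv, smul_eq_mul]
      refine mul_nonneg (by positivity) (integral_nonneg fun y => ?_)
      exact mul_nonneg (radialWeight_nonneg _ _) (by linarith [hlap k (t • y), hpos (k + 1) (t • y)])
    have h0 : A 0 = E k 0 * radialMass d (N + 1) := by
      simp only [A, zero_smul, integral_mul_const]
      rw [mul_comm]
      rfl
    have := hmono (Set.mem_Ici.2 le_rfl) ht ht
    rw [h0] at this
    simp only [add_zero, mul_zero, pow_zero, mul_one, Nat.factorial_zero, Nat.cast_one, one_mul]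
    rw [mul_comm]
    gcongr
  | succ j ih =>
    set A : ℝ → ℝ := fun t => ∫ y, radialWeight (N + 1) y * E k (t • y)
    have hA : ∀ t, HasDerivAt A _ t := fun t =>
      hasDerivAt_integral_radialWeight_smul_laplace (hE k) N t
    -- The coefficient for which the claim reads `c t^(2(j+1)) ≤ A t`. The induction hypothesis for
    -- `E (k + 1)` with the next weight says exactly that `A` grows at least as fast as this
    -- monomial.
    set c : ℝ := E (k + (j + 1)) 0 * radialMass d (N + 1 + (j + 1)) * (N + 1).factorial /
      (2 ^ (j + 1) * (j + 1).factorial * (N + 1 + (j + 1)).factorial) with hc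
    have hder : ∀ t, HasDerivAt (fun t => A t - c * t ^ (2 * (j + 1))) _ t := fun t =>
      (hA t).sub ((hasDerivAt_pow (2 * (j + 1)) t).const_mul c)
    have hmono : MonotoneOn (fun t => A t - c * t ^ (2 * (j + 1))) (Set.Ici 0) := by
      refine monotoneOn_of_deriv_nonneg (convex_Ici 0)
        (fun t _ => (hder t).continuousAt.continuousWithinAt)
        (fun t _ => (hder t).differentiableAt.differentiableWithinAt) fun t ht => ?_
      rw [interior_Ici, Set.mem_Ioi] at ht
      rw [(hder t).deriv, smul_eq_mul, sub_nonneg]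
      have hI : 2 * ∫ y, radialWeight (N + 2) y * E (k + 1) (t • y) ≤
          ∫ y, radialWeight (N + 2) y • laplace (E k) (t • y) := by
        rw [← integral_const_mul]
        refine integral_mono ?_ ?_ fun y => ?_
        · exact (integrable_smul_of_hasCompactSupport (continuous_radialWeight (N + 2))
            (hasCompactSupport_radialWeight (N + 1))
            ((hE (k + 1)).continuous.comp (continuous_const_smul t))).const_mul 2
        · refine integrable_smul_of_hasCompactSupport (continuous_radialWeight (N + 2))
            (hasCompactSupport_radialWeight (N + 1))
            (Continuous.comp (g := laplace (E k)) ?_ (continuous_const_smul t))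
          exact continuous_finsetSum _ fun i _ =>
            (contDiff_partialD (l := 0) (contDiff_partialD (l := 1) (hE k) (by norm_num) i)
              (by simp) i).continuous
        · have := mul_le_mul_of_nonneg_left (hlap k (t • y)) (radialWeight_nonneg (N + 2) y)
          simp only [smul_eq_mul]
          linarith
      have hih := ih (k + 1) (N + 1) ht.le
      have e1 : k + 1 + j = k + (j + 1) := by omega
      have e2 : N + 1 + 1 + j = N + 1 + (j + 1) := by omega
      rw [e1, e2] at hih
      set J := ∫ y, radialWeight (N + 1 + 1) y * E (k + 1) (t • y)
      have hcj : c * (2 ^ (j + 1) * (j + 1).factorial * (N + 1 + (j + 1)).factorial) =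
          E (k + (j + 1)) 0 * radialMass d (N + 1 + (j + 1)) * (N + 1).factorial := by
        rw [hc, div_mul_cancel₀ _ (by positivity)]
      have hJ : c * (2 * (j + 1)) * (N + 2) * t ^ (2 * j) ≤ J := by
        have hp : (0 : ℝ) < 2 ^ j * j.factorial * (N + 1 + (j + 1)).factorial := by positivity
        rw [← mul_le_mul_iff_right₀ hp]
        refine le_trans (le_of_eq ?_) hih
        have hf1 : ((j + 1).factorial : ℝ) = (j + 1) * j.factorial := by
          rw [Nat.factorial_succ]; push_cast; ring
        have hf2 : ((N + 1 + 1).factorial : ℝ) = (N + 2) * (N + 1).factorial := by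
          rw [Nat.factorial_succ (N + 1)]; push_cast; ring
        rw [hf1] at hcj
        rw [hf2]
        linear_combination ((N + 2 : ℝ) * t ^ (2 * j)) * hcj
      have hpow : 2 * (j + 1) - 1 = 2 * j + 1 := by omega
      rw [hpow]
      have hN : (0 : ℝ) < N + 2 := by positivity
      calc _ = t / (2 * (N + 2)) * (2 * (c * (2 * (j + 1)) * (N + 2) * t ^ (2 * j))) := by
            push_cast
            field_simp
            ring
        _ ≤ t / (2 * (N + 2)) * (2 * J) := by gcongr
        _ ≤ _ := by gcongr
    have h0 : 0 ≤ A 0 := by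
      simp only [A, zero_smul]
      exact integral_nonneg fun y => mul_nonneg (radialWeight_nonneg _ _) (hpos _ _)
    have h1 := hmono (Set.mem_Ici.2 le_rfl) ht ht
    simp only [zero_pow (by omega : 2 * (j + 1) ≠ 0), mul_zero, sub_zero] at h1
    have h2 : c * t ^ (2 * (j + 1)) ≤ A t := by linarith
    rw [hc, div_mul_eq_mul_div, div_le_iff₀ (by positivity)] at h2
    refine (le_of_eq ?_).trans (h2.trans (le_of_eq ?_)) <;> ring

/-- The Pizzetti-type bound started at `E_0 = u²`, which is at most `M²` wherever the weight,
dilated to radius `r`, is nonzero. -/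
theorem gradEnergy_zero_le {u : Paravector n → ℝ} (hu : ContDiff ℝ ∞ u)
    (h0 : ∀ x, laplace u x = 0) {r M : ℝ} (hr : 0 ≤ r) (hM : ∀ x, ‖x‖ ≤ r → |u x| ≤ M) (K : ℕ) :
    gradEnergy u K 0 * radialMass (n + 1) (K + 1) * r ^ (2 * K) ≤
      2 ^ K * K.factorial * (K + 1).factorial * (M ^ 2 * radialMass (n + 1) 1) := by
  have h := le_integral_radialWeight_of_two_mul_le_laplace
    (fun k => contDiff_infty.1 (contDiff_gradEnergy hu k) 2) (gradEnergy_nonneg u)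
    (two_mul_gradEnergy_succ_le hu h0) K 0 0 hr
  simp only [zero_add, Nat.factorial_one, Nat.cast_one, mul_one, add_comm 1 K] at h
  refine h.trans ?_
  gcongr
  have hc : Continuous fun y : Paravector n => gradEnergy u 0 (r • y) :=
    (contDiff_gradEnergy hu 0).continuous.comp (by fun_prop)
  rw [radialMass, ← integral_const_mul]
  refine integral_mono (integrable_smul_of_hasCompactSupport (continuous_radialWeight 1)
    (hasCompactSupport_radialWeight 0) hc) ((integrable_radialWeight 0).const_mul _) fun y => ?_
  simp only
  rcases le_or_gt ‖y‖ 1 with hy | hy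
  · rw [mul_comm]
    refine mul_le_mul_of_nonneg_right ?_ (radialWeight_nonneg _ _)
    have h1 : |u (r • y)| ≤ M := hM _ (by
      rw [norm_smul, Real.norm_of_nonneg hr]; exact mul_le_of_le_one_right hr hy)
    have h2 : gradEnergy u 0 (r • y) = u (r • y) ^ 2 := by
      simp [gradEnergy, wordDeriv]
    rw [h2, ← sq_abs]
    gcongr
  · rw [radialWeight_eq_zero 0 hy]; simp

end Energy

/-! ### Cauchy estimates -/

section Cauchy

variable {n : ℕ}

theorem natCast_succ_le_mul_pow (K : ℕ) : (K + 1 : ℝ) ≤ 8 * (9 / 8 : ℝ) ^ K := by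
  have h := one_add_mul_le_pow (by norm_num : (-2 : ℝ) ≤ 1 / 8) K
  norm_num at h
  linarith

/-- Cauchy estimates for harmonic functions, along words without `x₀`. -/
theorem exists_wordDeriv_bound (n : ℕ) : ∃ C : ℝ, 0 < C ∧ ∀ u : Paravector n → ℝ,
    ContDiff ℝ ∞ u → (∀ x, laplace u x = 0) → ∀ r M : ℝ, 0 < r → 0 ≤ M →
    (∀ x, ‖x‖ ≤ r → |u x| ≤ M) → ∀ m : Fin n → ℕ,
    |(∏ i, ((m i).factorial : ℝ))⁻¹ * wordDeriv (sortedWord m) u 0| ≤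
      C * M * (9 / 10 * ((n + 1) / r)) ^ (∑ i, m i) := by
  obtain ⟨c, hc, hmass⟩ := exists_le_radialMass (n + 1)
  set μ := radialMass (n + 1) 1 with hμ
  have hμ0 : 0 < μ := radialMass_pos _ 0
  set C := Real.sqrt (8 * μ * (4 / 3) / c) with hC
  have hC2 : C ^ 2 = 8 * μ * (4 / 3) / c := Real.sq_sqrt (by positivity)
  refine ⟨C, Real.sqrt_pos.2 (by positivity), fun u hu h0 r M hr hM hb m => ?_⟩
  set K := ∑ i, m i with hK
  set P : ℝ := ∏ i, ((m i).factorial : ℝ) with hP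
  have hP0 : 0 < P := by positivity
  set D := wordDeriv (sortedWord m) u 0
  set W : ℝ := (wordCard m : ℝ)
  have h1 : W * D ^ 2 ≤ gradEnergy u K 0 := wordCard_mul_sq_le_gradEnergy hu m 0
  have h2 := gradEnergy_zero_le hu h0 hr.le hb K
  have h3 : P * W = K.factorial := prod_factorial_mul_wordCard m
  have h4 : W ≤ (n : ℝ) ^ K := (Nat.cast_le.2 (wordCard_le m)).trans_eq (Nat.cast_pow n K)
  have hKf : (0 : ℝ) < K.factorial := by positivity
  have hW0 : 0 < W := by
    refine (pos_iff_pos_of_mul_pos ?_).1 hP0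
    rwa [h3]
  have hg := gradEnergy_nonneg u K 0
  have h5 : gradEnergy u K 0 * (c * (3 / 4) ^ (K + 1)) * r ^ (2 * K) ≤
      2 ^ K * K.factorial * (K + 1).factorial * (M ^ 2 * μ) := by
    refine le_trans ?_ h2
    gcongr
    exact hmass K
  -- Both factorials are rewritten through `K! = m! · W`, so that `(m!)²` can be moved to the left
  -- and a single factor `W` survives on the right.
  have h6 : W * D ^ 2 * (c * (3 / 4) ^ (K + 1)) * r ^ (2 * K) ≤
      2 ^ K * (P * W) * ((K + 1) * (P * W)) * (M ^ 2 * μ) := by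
    rw [h3]
    refine le_trans (by gcongr) (h5.trans (le_of_eq ?_))
    rw [Nat.factorial_succ]; push_cast; ring
  have h7 : (P⁻¹ * D) ^ 2 * (c * (3 / 4) ^ (K + 1)) * r ^ (2 * K) ≤
      2 ^ K * W * (K + 1) * (M ^ 2 * μ) := by
    have hp : 0 < P ^ 2 * W := by positivity
    rw [← mul_le_mul_iff_right₀ hp]
    refine le_trans (le_of_eq ?_) (h6.trans (le_of_eq ?_))
    · field_simp
    · ring
  -- The rate is `2 · n · 9/8 = 9n/4`, and `4n ≤ (n+1)²`; the factor `K + 1` costs the `9/8`.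
  have h8 : (2 : ℝ) ^ K * W * (K + 1) ≤ 8 * (9 / 16 * (n + 1) ^ 2) ^ K := by
    calc (2 : ℝ) ^ K * W * (K + 1) ≤ 2 ^ K * n ^ K * (8 * (9 / 8) ^ K) := by
          gcongr
          exact natCast_succ_le_mul_pow K
      _ = 8 * (9 / 4 * n : ℝ) ^ K := by
          rw [← mul_pow, mul_left_comm, ← mul_pow]; congr 2; ring
      _ ≤ _ := by
          refine mul_le_mul_of_nonneg_left (pow_le_pow_left₀ (by positivity) ?_ K) (by norm_num)
          nlinarith [sq_nonneg ((n : ℝ) - 1)]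
  have h9 : (P⁻¹ * D) ^ 2 ≤ (C * M * (9 / 10 * ((n + 1) / r)) ^ K) ^ 2 := by
    have hp : 0 < c * (3 / 4 : ℝ) ^ (K + 1) * r ^ (2 * K) := by positivity
    rw [← mul_le_mul_iff_left₀ hp]
    calc (P⁻¹ * D) ^ 2 * (c * (3 / 4) ^ (K + 1) * r ^ (2 * K))
        ≤ 2 ^ K * W * (K + 1) * (M ^ 2 * μ) := by rw [← mul_assoc]; exact h7
      _ ≤ 8 * (9 / 16 * (n + 1) ^ 2) ^ K * (M ^ 2 * μ) := by gcongr
      _ = 8 * μ * M ^ 2 * ((9 / 16 * (n + 1) ^ 2) ^ K) := by ring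
      -- The lower bound on the mass is divided out: `9/16 ≤ (9/10)² · 3/4`. The spare `3/4` of the
      -- exponent `K + 1` is the `4/3` in `C`.
      _ ≤ 8 * μ * M ^ 2 * ((81 / 100 * (3 / 4) * (n + 1) ^ 2) ^ K) := by
        gcongr
        norm_num
      _ = _ := by
        have e1 : (C * M * (9 / 10 * ((n + 1) / r)) ^ K) ^ 2 =
            C ^ 2 * M ^ 2 * (81 / 100 * (n + 1) ^ 2) ^ K / r ^ (2 * K) := by
          rw [mul_pow, mul_pow, ← pow_mul, mul_comm K 2, pow_mul, pow_mul r, mul_div_assoc,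
            ← div_pow]
          congr 2
          ring
        rw [e1, hC2, mul_right_comm _ (3 / 4 : ℝ), mul_pow _ (3 / 4 : ℝ)]
        field_simp
        ring
  exact abs_le_of_sq_le_sq h9 (by positivity)

/-- The coordinate of index `A` in the Clifford algebra. -/
noncomputable def clCoordCLM (A : Finset (Fin n)) : Cl n →L[ℝ] ℝ :=
  LinearMap.toContinuousLinearMap ((clBasis n).coord A)

theorem norm_sq_eq_sum_clCoordCLM (y : Cl n) : ‖y‖ ^ 2 = ∑ A, clCoordCLM A y ^ 2 :=
  cl_norm_sq y

theorem abs_clCoordCLM_le (A : Finset (Fin n)) (y : Cl n) : |clCoordCLM A y| ≤ ‖y‖ := by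
  refine abs_le_of_sq_le_sq ?_ (norm_nonneg y)
  rw [norm_sq_eq_sum_clCoordCLM]
  exact Finset.single_le_sum (f := fun A => clCoordCLM A y ^ 2) (fun _ _ => sq_nonneg _)
    (Finset.mem_univ A)

theorem laplace_clm_comp {d : ℕ} {F G : Type*} [NormedAddCommGroup F] [NormedSpace ℝ F]
    [NormedAddCommGroup G] [NormedSpace ℝ G] (L : F →L[ℝ] G) {f : EuclideanSpace ℝ (Fin d) → F}
    (hf : ContDiff ℝ 2 f) (x : EuclideanSpace ℝ (Fin d)) :
    laplace (fun x => L (f x)) x = L (laplace f x) := by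
  simp only [laplace, map_sum]
  refine Finset.sum_congr rfl fun j _ => ?_
  rw [partialD_clm_comp L (hf.of_le (by norm_num)),
    partialD_clm_comp L (contDiff_partialD hf (by norm_num) j)]

/-- Cauchy estimates for the Taylor coefficients of left monogenic functions. -/
theorem exists_taylorCoeff_bound (n : ℕ) : ∃ C : ℝ, 0 < C ∧ ∀ f : Paravector n → Cl n,
    IsLeftMonogenic f → ∀ r M : ℝ, 0 < r → 0 ≤ M → (∀ x, ‖x‖ ≤ r → ‖f x‖ ≤ M) →
    ∀ m : Fin n → ℕ, ‖taylorCoeff f m‖ ≤ C * M * (9 / 10 * ((n + 1) / r)) ^ (∑ i, m i) := by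
  obtain ⟨C, hC, h⟩ := exists_wordDeriv_bound n
  set T : ℝ := (Fintype.card (Finset (Fin n)) : ℝ) with hT
  have hT0 : 0 < T := Nat.cast_pos.2 Fintype.card_pos
  refine ⟨Real.sqrt T * C, by positivity, fun f hf r M hr hM hb m => ?_⟩
  have hcoord : ∀ A, |clCoordCLM A (taylorCoeff f m)| ≤
      C * M * (9 / 10 * ((n + 1) / r)) ^ (∑ i, m i) := by
    intro A
    have h1 := h (fun x => clCoordCLM A (f x)) ((clCoordCLM A).contDiff.comp hf.contDiff)
      (fun x => by
        rw [laplace_clm_comp _ (contDiff_infty.1 hf.contDiff 2), hf.laplace_eq_zero, map_zero])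
      r M hr hM (fun x hx => (abs_clCoordCLM_le A _).trans (hb x hx)) m
    rw [wordDeriv_clm_comp _ hf.contDiff] at h1
    rwa [taylorCoeff, multiDeriv_eq_wordDeriv, map_smul, smul_eq_mul]
  set B := C * M * (9 / 10 * ((n + 1) / r)) ^ (∑ i, m i) with hB
  have hB0 : 0 ≤ B := by positivity
  have h2 : ‖taylorCoeff f m‖ ^ 2 ≤ (Real.sqrt T * B) ^ 2 := by
    rw [norm_sq_eq_sum_clCoordCLM, mul_pow, Real.sq_sqrt hT0.le]
    refine (Finset.sum_le_card_nsmul Finset.univ _ (B ^ 2) fun A _ => ?_).trans_eq ?_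
    · rw [← sq_abs]
      exact pow_le_pow_left₀ (abs_nonneg _) (hcoord A) 2
    · rw [nsmul_eq_mul, hT, Finset.card_univ]
  calc ‖taylorCoeff f m‖ ≤ Real.sqrt T * B := le_of_sq_le_sq h2 (by positivity)
    _ = _ := by rw [hB]; ring

end Cauchy

/-! ### Scaling of proximate orders -/

section ProximateOrder

variable {ρ : ℝ → ℝ} {ρ₀ : ℝ}

theorem IsProximateOrder.hasDerivAt_mul_log (hρ : IsProximateOrder ρ ρ₀) {r : ℝ} (hr : 0 < r) :
    HasDerivAt (fun r => ρ r * Real.log r) (r⁻¹ * (deriv ρ r * r * Real.log r + ρ r)) r := by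
  have h1 : HasDerivAt ρ (deriv ρ r) r :=
    ((hρ.differentiable r hr.le).differentiableAt (Ici_mem_nhds hr)).hasDerivAt
  refine (h1.mul (Real.hasDerivAt_log hr.ne')).congr_deriv ?_
  field_simp

/-- Eventually `ρ(r) log r` is nondecreasing, and grows at most like `(ρ₀ + ε) log r`. -/
theorem IsProximateOrder.exists_monotone (hρ : IsProximateOrder ρ ρ₀) (hρ₀ : 0 < ρ₀) {ε : ℝ}
    (hε : 0 < ε) : ∃ R : ℝ, 1 ≤ R ∧
      MonotoneOn (fun r => ρ r * Real.log r) (Set.Ici R) ∧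
      AntitoneOn (fun r => ρ r * Real.log r - (ρ₀ + ε) * Real.log r) (Set.Ici R) := by
  -- This is `r` times the derivative of `ρ(r) log r`; a limit strictly between `0` and `ρ₀ + ε`
  -- gives both monotonicity statements.
  have hlim : Tendsto (fun r => deriv ρ r * r * Real.log r + ρ r) atTop (𝓝 ρ₀) := by
    simpa using hρ.tendsto_deriv.add hρ.tendsto
  obtain ⟨R, hR⟩ := eventually_atTop.1 ((hlim.eventually (lt_mem_nhds hρ₀)).and
    (hlim.eventually (gt_mem_nhds (by linarith : ρ₀ < ρ₀ + ε))))
  have hpos : ∀ r ∈ Set.Ici (max R 1), 0 < r := fun r hr =>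
    one_pos.trans_le ((le_max_right R 1).trans hr)
  have hder2 : ∀ r ∈ Set.Ici (max R 1), HasDerivAt
      (fun r => ρ r * Real.log r - (ρ₀ + ε) * Real.log r) _ r := fun r hr =>
    (hρ.hasDerivAt_mul_log (hpos r hr)).sub ((Real.hasDerivAt_log (hpos r hr).ne').const_mul _)
  refine ⟨max R 1, le_max_right _ _, ?_, ?_⟩
  · refine monotoneOn_of_deriv_nonneg (convex_Ici _)
      (fun r hr => (hρ.hasDerivAt_mul_log (hpos r hr)).continuousAt.continuousWithinAt)
      (fun r hr => (hρ.hasDerivAt_mul_log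
        (hpos r (interior_subset hr))).differentiableAt.differentiableWithinAt) fun r hr => ?_
    have hr' := interior_subset hr
    have h0 := hpos r hr'
    rw [(hρ.hasDerivAt_mul_log h0).deriv]
    have := (hR r ((le_max_left R 1).trans hr')).1
    positivity
  · refine antitoneOn_of_deriv_nonpos (convex_Ici _)
      (fun r hr => (hder2 r hr).continuousAt.continuousWithinAt)
      (fun r hr => (hder2 r (interior_subset hr)).differentiableAt.differentiableWithinAt)
      fun r hr => ?_
    have hr' := interior_subset hr
    have h0 := hpos r hr'
    rw [(hder2 r hr').deriv]
    have := (hR r ((le_max_left R 1).trans hr')).2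
    have h2 : r⁻¹ * (deriv ρ r * r * Real.log r + ρ r) - (ρ₀ + ε) * r⁻¹ =
        -(r⁻¹ * (ρ₀ + ε - (deriv ρ r * r * Real.log r + ρ r))) := by ring
    rw [h2, neg_nonpos]
    exact mul_nonneg (inv_nonneg.2 h0.le) (by linarith)

theorem IsProximateOrder.exists_rpow_le_of_le (hρ : IsProximateOrder ρ ρ₀) (R : ℝ) :
    ∃ B : ℝ, 0 < B ∧ ∀ y, 0 ≤ y → y ≤ R → y ^ ρ y ≤ B := by
  obtain ⟨P, hP⟩ := isCompact_Icc.exists_bound_of_continuousOn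
    (hρ.differentiable.continuousOn.mono (fun y hy => hy.1 : Set.Icc 0 R ⊆ Set.Ici 0))
  refine ⟨(max 1 R) ^ P, by positivity, fun y hy hyR => ?_⟩
  have h1 : ρ y ≤ P := (le_abs_self _).trans (hP y ⟨hy, hyR⟩)
  calc y ^ ρ y ≤ (max 1 R) ^ ρ y :=
        Real.rpow_le_rpow hy (hyR.trans (le_max_right _ _)) (hρ.nonneg y hy)
    _ ≤ _ := Real.rpow_le_rpow_of_exponent_le (le_max_left _ _) h1

theorem exists_rpow_add_le {c η ρ₀ : ℝ} (hc : 0 < c) (hη : 0 < η) :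
    ∃ ε : ℝ, 0 < ε ∧ c ^ (ρ₀ + ε) ≤ (1 + η) * c ^ ρ₀ := by
  have hcont : Tendsto (fun ε : ℝ => c ^ ε) (𝓝 0) (𝓝 1) := by
    have : Continuous fun ε : ℝ => c ^ ε := Real.continuous_const_rpow hc.ne'
    simpa using this.tendsto 0
  have h := hcont.eventually (gt_mem_nhds (by linarith : (1 : ℝ) < 1 + η))
  obtain ⟨δ, hδ, h⟩ := Metric.eventually_nhds_iff.1 h
  refine ⟨δ / 2, by positivity, ?_⟩
  rw [Real.rpow_add hc, mul_comm]
  gcongr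
  exact (h (by rw [Real.dist_eq, sub_zero, abs_of_pos (by positivity)]; linarith)).le

/-- Up to a factor close to `1` and a constant, `r ^ ρ(r)` scales like `r ^ ρ₀`. -/
theorem IsProximateOrder.exists_rpow_le (hρ : IsProximateOrder ρ ρ₀) (hρ₀ : 0 < ρ₀) {c η : ℝ}
    (hc : 1 ≤ c) (hη : 0 < η) :
    ∃ B : ℝ, 0 < B ∧ ∀ s y, 0 ≤ s → 0 ≤ y → y ≤ c * max s 1 →
      y ^ ρ y ≤ (1 + η) * c ^ ρ₀ * s ^ ρ s + B := by
  have hc0 : 0 < c := by linarith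
  obtain ⟨ε, hε, hcε⟩ := exists_rpow_add_le (ρ₀ := ρ₀) hc0 hη
  obtain ⟨R, hR, hmono, hanti⟩ := hρ.exists_monotone hρ₀ hε
  obtain ⟨B, hB, hbound⟩ := hρ.exists_rpow_le_of_le (c * R)
  refine ⟨B, hB, fun s y hs hy hys => ?_⟩
  have hnn : 0 ≤ (1 + η) * c ^ ρ₀ * s ^ ρ s := by positivity
  have hexp : ∀ y : ℝ, R ≤ y → y ^ ρ y = Real.exp (ρ y * Real.log y) := fun y hy => by
    rw [Real.rpow_def_of_pos (by linarith), mul_comm]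
  rcases le_or_gt y (c * R) with h | h
  -- For `y` in a compact range the additive constant `B` suffices. Otherwise `y > cR` forces both
  -- `s` and `y` beyond `R`.
  · linarith [hbound y hy h]
  · have hsR : R < s := by
      by_contra! hcon
      have : max s 1 ≤ R := max_le hcon hR
      nlinarith
    have hs1 : max s 1 = s := max_eq_left (by linarith)
    rw [hs1] at hys
    have hyR : R < y := by nlinarith
    have hs0 : 0 < s := by linarith
    have hy0 : 0 < y := by linarith
    have hlog : Real.log y ≤ Real.log c + Real.log s := by
      rw [← Real.log_mul hc0.ne' hs0.ne']
      exact Real.log_le_log hy0 hys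
    have hlogc : 0 ≤ Real.log c := Real.log_nonneg hc
    -- Monotonicity handles `y ≤ s`; for `s ≤ y` the growth bound gives at most `(ρ₀ + ε)(log y -
    -- log s)`, and `y ≤ cs`.
    have key : ρ y * Real.log y ≤ (ρ₀ + ε) * Real.log c + ρ s * Real.log s := by
      rcases le_total y s with hle | hle
      · have := hmono hyR.le hsR.le hle
        simp only at this
        have := mul_nonneg (by linarith : 0 ≤ ρ₀ + ε) hlogc
        linarith
      · have := hanti hsR.le hyR.le hle
        simp only at this
        nlinarith
    have h1 : y ^ ρ y ≤ c ^ (ρ₀ + ε) * s ^ ρ s := by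
      rw [hexp y hyR.le, hexp s hsR.le, Real.rpow_def_of_pos hc0, ← Real.exp_add]
      exact Real.exp_le_exp.2 (by linarith)
    have h2 : c ^ (ρ₀ + ε) * s ^ ρ s ≤ (1 + η) * c ^ ρ₀ * s ^ ρ s := by gcongr
    linarith

end ProximateOrder

/-! ### Termwise differentiation of Fueter series -/

section Series

variable {n : ℕ}

/-- The general term `V_m a` of a Fueter series has this derivative. -/
noncomputable def fueterTermDeriv (m : Fin n → ℕ) (a : Cl n) (x : Paravector n) :
    Paravector n →L[ℝ] Cl n :=
  (mulRightCLM a).comp (fueterPolyDeriv m x)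

theorem hasFDerivAt_fueterPoly_mul (m : Fin n → ℕ) (a : Cl n) (x : Paravector n) :
    HasFDerivAt (fun x => fueterPoly m x * a) (fueterTermDeriv m a x) x :=
  (mulRightCLM a).hasFDerivAt.comp x (hasFDerivAt_fueterPoly m x)

theorem continuous_fueterTermDeriv (m : Fin n → ℕ) (a : Cl n) :
    Continuous (fueterTermDeriv m a) :=
  continuous_const.clm_comp (continuous_fueterPolyDeriv m)

theorem norm_fueterTermDeriv_le (m : Fin n → ℕ) (a : Cl n) {x : Paravector n} {R : ℝ}
    (hR : 1 ≤ R) (hx : ‖x‖ ≤ R) :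
    ‖fueterTermDeriv m a x‖ ≤ (2 * R) ^ (∑ i, m i) * ‖a‖ := by
  refine ContinuousLinearMap.opNorm_le_bound _ (by positivity) fun h => ?_
  refine (norm_fueterPolyDeriv_apply_mul_le m x h a).trans ?_
  set k := ∑ i, m i
  -- The factor `k` from differentiation is absorbed by `k ≤ 2 ^ k`; doubling the radius is free for
  -- coefficients summable at every radius.
  have h1 : (k : ℝ) * ‖x‖ ^ (k - 1) ≤ (2 * R) ^ k := by
    rw [mul_pow]
    have h2 : (k : ℝ) ≤ 2 ^ k := by exact_mod_cast Nat.lt_two_pow_self.le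
    have h3 : ‖x‖ ^ (k - 1) ≤ R ^ k := (pow_le_pow_left₀ (norm_nonneg x) hx _).trans
      (pow_le_pow_right₀ hR (Nat.sub_le k 1))
    gcongr
  calc _ ≤ (2 * R) ^ k * ‖h‖ * ‖a‖ := by gcongr
    _ = _ := by ring

/-- A Fueter series whose coefficients decay superexponentially is entire left monogenic. -/
theorem isLeftMonogenic_tsum_fueterPoly_mul {ι : Type*} (m : ι → Fin n → ℕ) (a : ι → Cl n)
    (h : ∀ R : ℝ, 1 ≤ R → Summable fun p => R ^ (∑ i, m p i) * ‖a p‖) :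
    IsLeftMonogenic fun x => ∑' p, fueterPoly (m p) x * a p := by
  set S : Paravector n → Paravector n →L[ℝ] Cl n :=
    fun x => ∑' p, fueterTermDeriv (m p) (a p) x with hS
  have hbound : ∀ R : ℝ, 1 ≤ R → ∀ p, ∀ x ∈ Metric.ball (0 : Paravector n) R,
      ‖fueterTermDeriv (m p) (a p) x‖ ≤ (2 * R) ^ (∑ i, m p i) * ‖a p‖ := fun R hR p x hx =>
    norm_fueterTermDeriv_le _ _ hR (mem_ball_zero_iff.1 hx).le
  have hsum : ∀ R : ℝ, 1 ≤ R → Summable fun p => (2 * R) ^ (∑ i, m p i) * ‖a p‖ := fun R hR =>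
    h (2 * R) (by linarith)
  have hmem : ∀ x : Paravector n, x ∈ Metric.ball (0 : Paravector n) (‖x‖ + 1) := fun x => by simp
  have hone : ∀ x : Paravector n, 1 ≤ ‖x‖ + 1 := fun x => by linarith [norm_nonneg x]
  have hder : ∀ x, HasFDerivAt (fun x => ∑' p, fueterPoly (m p) x * a p) (S x) x := by
    intro x
    have h0 : Summable fun p => fueterPoly (m p) x * a p := by
      refine Summable.of_norm_bounded (h _ (hone x)) fun p =>
        (norm_fueterPoly_mul_le (m p) x (a p)).trans ?_
      gcongr
      linarith
    have hd : ∀ p, ∀ y ∈ Metric.ball (0 : Paravector n) (‖x‖ + 1), HasFDerivAt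
        (fun x => fueterPoly (m p) x * a p) (fueterTermDeriv (m p) (a p) y) y :=
      fun p y _ => hasFDerivAt_fueterPoly_mul (m p) (a p) y
    exact hasFDerivAt_tsum_of_isPreconnected (hsum (‖x‖ + 1) (hone x)) Metric.isOpen_ball
      (convex_ball 0 _).isPreconnected hd (hbound (‖x‖ + 1) (hone x)) (hmem x) h0 (hmem x)
  have hcont : Continuous S := by
    rw [continuous_iff_continuousAt]
    intro x
    exact (continuousOn_tsum (fun p => (continuous_fueterTermDeriv (m p) (a p)).continuousOn)
      (hsum _ (hone x)) (hbound _ (hone x))).continuousAt (Metric.isOpen_ball.mem_nhds (hmem x))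
  have hfd : fderiv ℝ (fun x => ∑' p, fueterPoly (m p) x * a p) = S :=
    funext fun x => (hder x).fderiv
  have hC1 : ContDiff ℝ 1 fun x => ∑' p, fueterPoly (m p) x * a p := by
    rw [contDiff_one_iff_fderiv, hfd]
    exact ⟨fun x => (hder x).differentiableAt, hcont⟩
  refine ⟨hC1, fun x => ?_⟩
  simp only [pderiv, hfd]
  have hsummable : Summable fun p => fueterTermDeriv (m p) (a p) x :=
    Summable.of_norm_bounded (hsum (‖x‖ + 1) (hone x))
      fun p => hbound (‖x‖ + 1) (hone x) p x (hmem x)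
  have hSx : HasSum (fun p => fueterTermDeriv (m p) (a p) x) (S x) := hsummable.hasSum
  have hv : ∀ v, HasSum (fun p => fueterTermDeriv (m p) (a p) x v) (S x v) := by
    intro v
    have := (ContinuousLinearMap.apply ℝ (Cl n) v).hasSum hSx
    simpa only [ContinuousLinearMap.apply_apply, Function.comp_def] using this
  have he : ∀ i : Fin n, HasSum (fun p => mulLeftCLM (unitE i)
      (fueterTermDeriv (m p) (a p) x (EuclideanSpace.single i.succ 1)))
      (mulLeftCLM (unitE i) (S x (EuclideanSpace.single i.succ 1))) := by
    intro i
    exact (mulLeftCLM (unitE i)).hasSum (hv (EuclideanSpace.single i.succ 1))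
  have hes := hasSum_sum fun (i : Fin n) (_ : i ∈ Finset.univ) => he i
  have htot := (hv (EuclideanSpace.single 0 1)).add hes
  have hzero : (fun p => fueterTermDeriv (m p) (a p) x (EuclideanSpace.single 0 1) +
      ∑ i, mulLeftCLM (unitE i) (fueterTermDeriv (m p) (a p) x (EuclideanSpace.single i.succ 1))) =
      fun _ => 0 := by
    -- Each term is annihilated by the Cauchy-Riemann operator: `V_m` is, and the coefficient
    -- multiplies from the right.
    funext p
    have := congrArg (· * a p) (fueterPolyDeriv_cauchyRiemann (m p) x)
    simpa [add_mul, Finset.sum_mul, fueterTermDeriv, mul_assoc] using this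
  rw [hzero] at htot
  simpa only [mulLeftCLM_apply] using htot.unique hasSum_zero

theorem summable_pow_sum {θ : ℝ} (h0 : 0 ≤ θ) (h1 : θ < 1) (n : ℕ) :
    Summable fun m : Fin n → ℕ => θ ^ (∑ i, m i) := by
  induction n with
  | zero => exact Summable.of_finite
  | succ n ih =>
    rw [← (Fin.consEquiv fun _ : Fin (n + 1) => ℕ).summable_iff]
    refine ((summable_geometric_of_lt_one h0 h1).mul_of_nonneg ih (fun _ => by positivity)
      (fun _ => by positivity)).congr fun p => ?_
    simp [Fin.consEquiv, Fin.sum_univ_succ, pow_add]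

end Series

/-! ### Growth of coefficients and the CK-product -/

section Growth

variable {n : ℕ} {ρ : ℝ → ℝ}

theorem growthNorm_nonneg (σ : ℝ) (f : Paravector n → Cl n) : 0 ≤ growthNorm ρ σ f :=
  Real.iSup_nonneg fun _ => mul_nonneg (norm_nonneg _) (Real.exp_nonneg _)

theorem norm_le_growthNorm_mul_exp {σ : ℝ} {f : Paravector n → Cl n} (hf : f ∈ growthSpace n ρ σ)
    (x : Paravector n) : ‖f x‖ ≤ growthNorm ρ σ f * Real.exp (σ * ‖x‖ ^ ρ ‖x‖) := by
  have h : weighted ρ σ f x ≤ growthNorm ρ σ f := le_ciSup hf.2 x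
  calc ‖f x‖ = weighted ρ σ f x * Real.exp (σ * ‖x‖ ^ ρ ‖x‖) := by
        rw [weighted, mul_assoc, ← Real.exp_add]; simp
    _ ≤ _ := by gcongr

theorem ckTerm_norm_le {K : ℝ} (hK : ∀ a b : Cl n, ‖a * b‖ ≤ K * ‖a‖ * ‖b‖)
    (f g : Paravector n → Cl n) (x : Paravector n) (p : (Fin n → ℕ) × (Fin n → ℕ)) :
    ‖ckTerm f g x p‖ ≤ ‖x‖ ^ (∑ i, p.1 i + ∑ i, p.2 i) *
      (K * ‖taylorCoeff f p.1‖ * ‖taylorCoeff g p.2‖) := by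
  refine (norm_fueterPoly_mul_le _ _ _).trans ?_
  simp only [Pi.add_apply, Finset.sum_add_distrib]
  gcongr
  exact hK _ _

/-- Taylor coefficients of functions of finite type, estimated on spheres of radius `s`. -/
theorem exists_taylorCoeff_growth_bound (n : ℕ) {ρ₀ : ℝ} (hρ₀ : 0 < ρ₀)
    (hρ : IsProximateOrder ρ ρ₀) {η : ℝ} (hη : 0 < η) :
    ∃ C B : ℝ, 0 < C ∧ ∀ τ : ℝ, 0 < τ → ∀ f ∈ growthSpace n ρ τ, ∀ s : ℝ, 0 ≤ s →
      ∀ m : Fin n → ℕ, max s 1 ^ (∑ i, m i) * ‖taylorCoeff f m‖ ≤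
        C * growthNorm ρ τ f * Real.exp (τ * ((1 + η) * (n + 1) ^ ρ₀ * s ^ ρ s + B)) *
          (9 / 10) ^ (∑ i, m i) := by
  obtain ⟨C, hC, hcoef⟩ := exists_taylorCoeff_bound n
  obtain ⟨B, hB, hbound⟩ := hρ.exists_rpow_le hρ₀
    (by linarith [(Nat.cast_nonneg n : (0 : ℝ) ≤ n)] : (1 : ℝ) ≤ n + 1) hη
  refine ⟨C, B, hC, fun τ hτ f hf s hs m => ?_⟩
  have hs1 : 0 < max s 1 := lt_max_of_lt_right one_pos
  have hn : (0 : ℝ) < n + 1 := by positivity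
  -- This radius cancels the `n + 1` of the Cauchy estimate, leaving `9/10` per degree; the maximum
  -- with `1` keeps it positive at `s = 0`.
  have h1 := hcoef f hf.1 ((n + 1) * max s 1)
    (growthNorm ρ τ f * Real.exp (τ * ((1 + η) * (n + 1) ^ ρ₀ * s ^ ρ s + B))) (by positivity)
    (mul_nonneg (growthNorm_nonneg _ _) (Real.exp_nonneg _)) (fun x hx => by
      refine (norm_le_growthNorm_mul_exp hf x).trans ?_
      refine mul_le_mul_of_nonneg_left (Real.exp_le_exp.2 ?_) (growthNorm_nonneg _ _)
      exact mul_le_mul_of_nonneg_left (hbound s ‖x‖ hs (norm_nonneg x) hx) hτ.le) m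
  refine (mul_le_mul_of_nonneg_left h1 (by positivity)).trans (le_of_eq ?_)
  have e : ((n : ℝ) + 1) / ((n + 1) * max s 1) = (max s 1)⁻¹ := by field_simp
  rw [e, mul_pow, inv_pow]
  field_simp

end Growth

theorem lemma3 (n : ℕ) (hn : 1 ≤ n) (ρ : ℝ → ℝ) (ρ₀ : ℝ) (hρ₀ : 0 < ρ₀)
    (hρ : IsProximateOrder ρ ρ₀) (η τ₁ τ₂ : ℝ) (hη : 0 < η) (hτ₁ : 0 < τ₁) (hτ₂ : 0 < τ₂) :
    ∃ C : ℝ, 0 < C ∧ ∀ δ : ℝ, 0 < δ →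
      ∀ g₁ ∈ growthSpace n ρ τ₁, ∀ g₂ ∈ growthSpace n ρ τ₂,
        (∀ x, Summable (ckTerm g₁ g₂ x)) ∧
        ckProduct g₁ g₂ ∈ growthSpace n ρ ((1 + η) * (n + δ + 1) ^ ρ₀ * (τ₁ + τ₂)) ∧
        growthNorm ρ ((1 + η) * (n + δ + 1) ^ ρ₀ * (τ₁ + τ₂)) (ckProduct g₁ g₂) ≤
          C * growthNorm ρ τ₁ g₁ * growthNorm ρ τ₂ g₂ := by
  obtain ⟨K, hK0, hK⟩ := exists_norm_mul_le n
  obtain ⟨C, B, hC, hcoef⟩ := exists_taylorCoeff_growth_bound n hρ₀ hρ hη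
  have hgeom := summable_pow_sum (by norm_num : (0 : ℝ) ≤ 9 / 10) (by norm_num) n
  have hgeom2 := hgeom.mul_of_nonneg hgeom (fun _ => by positivity) (fun _ => by positivity)
  set T : ℝ := ∑' p : (Fin n → ℕ) × (Fin n → ℕ),
    (9 / 10 : ℝ) ^ (∑ i, p.1 i) * (9 / 10 : ℝ) ^ (∑ i, p.2 i) with hT
  have hT0 : 0 < T := hgeom2.tsum_pos (fun _ => by positivity) 0 (by positivity)
  refine ⟨K * C ^ 2 * T * Real.exp ((τ₁ + τ₂) * B), by positivity, fun δ hδ g₁ hg₁ g₂ hg₂ => ?_⟩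
  set N₁ := growthNorm ρ τ₁ g₁
  set N₂ := growthNorm ρ τ₂ g₂
  have hN₁ : 0 ≤ N₁ := growthNorm_nonneg _ _
  have hN₂ : 0 ≤ N₂ := growthNorm_nonneg _ _
  -- Both coefficient bounds are taken at the same `s`, so the types add to `τ₁ + τ₂`.
  set Φ : ℝ → ℝ := fun s => K * C ^ 2 * N₁ * N₂ *
    Real.exp ((τ₁ + τ₂) * ((1 + η) * (n + 1) ^ ρ₀ * s ^ ρ s + B)) with hΦ
  have hprod : ∀ s : ℝ, 0 ≤ s → ∀ p : (Fin n → ℕ) × (Fin n → ℕ),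
      max s 1 ^ (∑ i, p.1 i + ∑ i, p.2 i) * (K * ‖taylorCoeff g₁ p.1‖ * ‖taylorCoeff g₂ p.2‖) ≤
        Φ s * ((9 / 10) ^ (∑ i, p.1 i) * (9 / 10) ^ (∑ i, p.2 i)) := by
    intro s hs p
    have h1 := hcoef τ₁ hτ₁ g₁ hg₁ s hs p.1
    have h2 := hcoef τ₂ hτ₂ g₂ hg₂ s hs p.2
    have h3 := mul_le_mul_of_nonneg_left (mul_le_mul h1 h2 (by positivity) (by positivity)) hK0.le
    refine (le_of_eq ?_).trans (h3.trans (le_of_eq ?_))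
    · rw [pow_add]; ring
    · rw [hΦ]
      simp only [add_mul τ₁ τ₂, Real.exp_add]
      ring
  have hterm : ∀ x p, ‖ckTerm g₁ g₂ x p‖ ≤
      Φ ‖x‖ * ((9 / 10) ^ (∑ i, p.1 i) * (9 / 10) ^ (∑ i, p.2 i)) := by
    intro x p
    refine (ckTerm_norm_le hK g₁ g₂ x p).trans (le_trans ?_ (hprod ‖x‖ (norm_nonneg x) p))
    gcongr
    exact le_max_left _ _
  have hnorm : ∀ x, ‖ckProduct g₁ g₂ x‖ ≤ Φ ‖x‖ * T := by
    intro x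
    rw [hT, ← tsum_mul_left]
    exact tsum_of_norm_bounded (hgeom2.mul_left _).hasSum (hterm x)
  have hweighted : ∀ x, weighted ρ ((1 + η) * (n + δ + 1) ^ ρ₀ * (τ₁ + τ₂)) (ckProduct g₁ g₂) x ≤
      K * C ^ 2 * T * Real.exp ((τ₁ + τ₂) * B) * N₁ * N₂ := by
    intro x
    -- The only use of `δ`: the estimate holds with `n + 1`, and a larger type only weakens it. The
    -- exponentials then cancel down to `exp((τ₁ + τ₂) B)`.
    have hpow : ((n : ℝ) + 1) ^ ρ₀ ≤ (n + δ + 1) ^ ρ₀ :=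
      Real.rpow_le_rpow (by positivity) (by linarith) hρ₀.le
    have hs : 0 ≤ ‖x‖ ^ ρ ‖x‖ := by positivity
    calc _ ≤ Φ ‖x‖ * T * Real.exp (-((1 + η) * (n + 1) ^ ρ₀ * (τ₁ + τ₂)) * ‖x‖ ^ ρ ‖x‖) := by
          rw [weighted]
          gcongr
          exact hnorm x
      _ = K * C ^ 2 * N₁ * N₂ * T *
          (Real.exp ((τ₁ + τ₂) * ((1 + η) * (n + 1) ^ ρ₀ * ‖x‖ ^ ρ ‖x‖ + B)) *
            Real.exp (-((1 + η) * (n + 1) ^ ρ₀ * (τ₁ + τ₂)) * ‖x‖ ^ ρ ‖x‖)) := by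
          simp only [hΦ]; ring
      _ = K * C ^ 2 * N₁ * N₂ * T * Real.exp ((τ₁ + τ₂) * B) := by
          rw [← Real.exp_add]
          congr 2
          ring
      _ = _ := by ring
  have hsummable : ∀ x, Summable (ckTerm g₁ g₂ x) := fun x =>
    Summable.of_norm_bounded (hgeom2.mul_left (Φ ‖x‖)) (hterm x)
  have hmonogenic := isLeftMonogenic_tsum_fueterPoly_mul
    (fun p : (Fin n → ℕ) × (Fin n → ℕ) => p.1 + p.2)
    (fun p => taylorCoeff g₁ p.1 * taylorCoeff g₂ p.2) fun R hR => ?_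
  · exact ⟨hsummable, ⟨hmonogenic, ⟨_, Set.forall_mem_range.2 hweighted⟩⟩, ciSup_le hweighted⟩
  -- The coefficient bound at `s = R` gives summability at each radius `R ≥ 1`, as termwise
  -- differentiation requires.
  refine Summable.of_nonneg_of_le (fun p => by positivity) (fun p => ?_)
    (hgeom2.mul_left (Φ R))
  refine le_trans ?_ (hprod R (by linarith) p)
  simp only [Pi.add_apply, Finset.sum_add_distrib, max_eq_left hR]
  gcongr
  exact hK _ _
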